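/- Let $p$ be a prime, let $F$ be a finite field of characteristic $p$ and order $q=p^n$, so that $n=[F:\mathbb F_p]$, and let $\psi(x)=e^{2\pi i\,\mathrm{Tr}(x)/p}$, where $\mathrm{Tr}\colon F\to\mathbb F_p$ is the absolute trace. For a positive integer $d$ with $\gcd(d,q-1)=1$ and for $a\in F$ put $W_{F,d}(a)=\sum_{x\in F}\psi(x^d-ax)$, and let $$V_{F,d}=\min_{a\in F}\mathrm{val}_p\bigl(W_{F,d}(a)\bigr),$$ where $\mathrm{val}_p$ is the extension of the $p$-adic valuation of $\mathbb Q$ to $\mathbb Q(e^{2\pi i/p})$, so that $\mathrm{val}_p(1-e^{2\pi i/p})=1/(p-1)$. Call $d$ degenerate over a finite field $K$ of characteristic $p$ if $d$ is congruent to a power of $p$ modulo $|K|-1$, and nondegenerate over $K$ otherwise. Suppose that $n$ is not a power of $2$ (in particular $n\neq 1=2^0$), and let $\ell$ be the least odd prime divisor of $n$. Then there is a positive integer $d$ such that $$\gcd(d,q-1)=1,\quad d\text{ is nondegenerate over }F\text{ but degenerate over }\mathbb F_p,\quad\text{and}\quad V_{F,d}=\frac{\ell+1}{2\ell}\,n.\qquad(*)$$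 Moreover, if $p=2$, then both $d=2^{n/\ell}+1$ and $d=2^{2n/\ell}-2^{n/\ell}+1$ satisfy $(*)$; and if $p$ is odd, then both $d=(p^{2n/\ell}+1)/2$ and $d=p^{2n/\ell}-p^{n/\ell}+1$ satisfy $(*)$. In particular, if $3\mid n$, then there is a positive integer $d$ with $\gcd(d,q-1)=1$ that is nondegenerate over $F$ but degenerate over $\mathbb F_p$ and has $V_{F,d}=\frac23 n$. -/

import Mathlib

/-- The complex number `ζ_p = e^{2πi/p}`. -/
noncomputable def zetaP (p : ℕ) : ℂ := Complex.exp (2 * Real.pi * Complex.I / p)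

/-- The field `ℚ(e^{2πi/p})` as a subfield of `ℂ`. -/
noncomputable abbrev cycloField (p : ℕ) : IntermediateField ℚ ℂ :=
  IntermediateField.adjoin ℚ {zetaP p}

/-- `ζ_p` as an element of `ℚ(ζ_p)`. -/
noncomputable def zetaK (p : ℕ) : cycloField p :=
  ⟨zetaP p, IntermediateField.mem_adjoin_simple_self ℚ (zetaP p)⟩

theorem zetaP_isPrimitiveRoot (p : ℕ) [Fact p.Prime] : IsPrimitiveRoot (zetaP p) p :=
  Complex.isPrimitiveRoot_exp p (NeZero.ne p)

theorem zetaK_isPrimitiveRoot (p : ℕ) [Fact p.Prime] : IsPrimitiveRoot (zetaK p) p :=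
  IsPrimitiveRoot.of_map_of_injective (f := algebraMap (cycloField p) ℂ)
    (zetaP_isPrimitiveRoot p) (algebraMap (cycloField p) ℂ).injective

instance cycloField_isCyclotomicExtension (p : ℕ) [Fact p.Prime] :
    IsCyclotomicExtension {p} ℚ (cycloField p) := by
  have hζ := zetaP_isPrimitiveRoot p
  have hi : IsIntegral ℚ (zetaP p) := (hζ.isIntegral (NeZero.pos p)).tower_top
  change IsCyclotomicExtension {p} ℚ (cycloField p).toSubalgebra
  rw [IntermediateField.adjoin_simple_toSubalgebra_of_isAlgebraic hi.isAlgebraic]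
  exact hζ.adjoin_isCyclotomicExtension ℚ

instance cycloField_numberField (p : ℕ) [Fact p.Prime] : NumberField (cycloField p) :=
  IsCyclotomicExtension.numberField {p} ℚ (cycloField p)

/-- The element `ζ_p - 1` of the ring of integers of `ℚ(ζ_p)`. -/
noncomputable def zetaSubOne (p : ℕ) [Fact p.Prime] : NumberField.RingOfIntegers (cycloField p) :=
  (zetaK_isPrimitiveRoot p).toInteger - 1

theorem zetaSubOne_prime (p : ℕ) [Fact p.Prime] : Prime (zetaSubOne p) :=
  (zetaK_isPrimitiveRoot p).zeta_sub_one_prime'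

/-- The prime ideal `(1 - ζ_p)` of the ring of integers of `ℚ(ζ_p)`
(the only prime ideal above `p`). -/
noncomputable def primeAbove (p : ℕ) [Fact p.Prime] :
    IsDedekindDomain.HeightOneSpectrum (NumberField.RingOfIntegers (cycloField p)) where
  asIdeal := Ideal.span {zetaSubOne p}
  isPrime := (Ideal.span_singleton_prime (zetaSubOne_prime p).ne_zero).mpr (zetaSubOne_prime p)
  ne_bot := by simpa using (zetaSubOne_prime p).ne_zero

open Classical in
/-- The function underlying the `p`-adic valuation on `ℚ(ζ_p)`: the exponent of the prime
`(1 - ζ_p)` in `x`, divided by `p - 1`, with value `⊤` at `0`. -/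
noncomputable def valPFun (p : ℕ) [Fact p.Prime] (x : cycloField p) : WithTop ℚ :=
  if x = 0 then ⊤ else
    ((-((WithZero.log ((primeAbove p).valuation (cycloField p) x) : ℤ) : ℚ) / ((p : ℚ) - 1) : ℚ) :
      WithTop ℚ)

theorem sub_one_pos_of_prime (p : ℕ) [Fact p.Prime] : (0 : ℚ) < (p : ℚ) - 1 := by
  have h : (1 : ℚ) < p := by exact_mod_cast (Fact.out : p.Prime).one_lt
  linarith

theorem valPFun_of_ne_zero (p : ℕ) [Fact p.Prime] {x : cycloField p} (hx : x ≠ 0) :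
    valPFun p x = ((-((WithZero.log ((primeAbove p).valuation (cycloField p) x) : ℤ) : ℚ) /
      ((p : ℚ) - 1) : ℚ) : WithTop ℚ) :=
  if_neg hx

theorem valPFun_add (p : ℕ) [Fact p.Prime] (x y : cycloField p) :
    min (valPFun p x) (valPFun p y) ≤ valPFun p (x + y) := by
  by_cases hx : x = 0
  · simp [hx]
  by_cases hy : y = 0
  · simp [hy]
  by_cases hxy : x + y = 0
  · simp [valPFun, hxy]
  have hp := sub_one_pos_of_prime p
  set v := (primeAbove p).valuation (cycloField p) with hv
  rw [valPFun_of_ne_zero p hx, valPFun_of_ne_zero p hy, valPFun_of_ne_zero p hxy, min_le_iff]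
  have h0 : v (x + y) ≠ 0 := (Valuation.ne_zero_iff v).mpr hxy
  rcases le_max_iff.mp (v.map_add x y) with h | h
  · left
    have h1 := (WithZero.log_le_log h0 ((Valuation.ne_zero_iff v).mpr hx)).mpr h
    have h2 : ((WithZero.log (v (x + y)) : ℤ) : ℚ) ≤ (WithZero.log (v x) : ℤ) := by
      exact_mod_cast h1
    rw [WithTop.coe_le_coe]
    exact div_le_div_of_nonneg_right (neg_le_neg h2) hp.le
  · right
    have h1 := (WithZero.log_le_log h0 ((Valuation.ne_zero_iff v).mpr hy)).mpr h
    have h2 : ((WithZero.log (v (x + y)) : ℤ) : ℚ) ≤ (WithZero.log (v y) : ℤ) := by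
      exact_mod_cast h1
    rw [WithTop.coe_le_coe]
    exact div_le_div_of_nonneg_right (neg_le_neg h2) hp.le

theorem valPFun_mul (p : ℕ) [Fact p.Prime] (x y : cycloField p) :
    valPFun p (x * y) = valPFun p x + valPFun p y := by
  by_cases hx : x = 0
  · simp [valPFun, hx]
  by_cases hy : y = 0
  · simp [valPFun, hy]
  set v := (primeAbove p).valuation (cycloField p) with hv
  rw [valPFun_of_ne_zero p hx, valPFun_of_ne_zero p hy, valPFun_of_ne_zero p (mul_ne_zero hx hy),
    ← hv, map_mul, WithZero.log_mul ((Valuation.ne_zero_iff v).mpr hx)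
      ((Valuation.ne_zero_iff v).mpr hy), ← WithTop.coe_add]
  congr 1
  push_cast
  ring

/-- The `p`-adic valuation on `ℚ(e^{2πi/p})`, extending the one of `ℚ` and normalized by
`val_p (1 - e^{2πi/p}) = 1 / (p - 1)`; see `valP_one_sub_zetaK` and `valP_ratCast`. -/
noncomputable def valP (p : ℕ) [Fact p.Prime] : AddValuation (cycloField p) (WithTop ℚ) :=
  AddValuation.of (valPFun p) (by simp [valPFun]) (by simp [valPFun]) (valPFun_add p)
    (valPFun_mul p)

theorem valP_one_sub_zetaK (p : ℕ) [Fact p.Prime] :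
    valP p (1 - zetaK p) = ((1 / ((p : ℚ) - 1) : ℚ) : WithTop ℚ) := by
  have h : algebraMap (NumberField.RingOfIntegers (cycloField p)) (cycloField p) (zetaSubOne p)
      = zetaK p - 1 := by
    rw [zetaSubOne, map_sub, map_one]
    rfl
  have h1 : valP p (1 - zetaK p) = valPFun p (zetaK p - 1) :=
    (AddValuation.map_sub_swap (valP p) _ _)
  have h0 : zetaK p - 1 ≠ 0 :=
    sub_ne_zero.mpr ((zetaK_isPrimitiveRoot p).ne_one (Fact.out : p.Prime).one_lt)
  rw [h1, valPFun_of_ne_zero p h0, ← h, IsDedekindDomain.HeightOneSpectrum.valuation_of_algebraMap,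
    IsDedekindDomain.HeightOneSpectrum.intValuation_singleton _ (zetaSubOne_prime p).ne_zero rfl]
  simp

theorem valP_natCast_self (p : ℕ) [Fact p.Prime] : valP p (p : cycloField p) = 1 := by
  have hp := sub_one_pos_of_prime p
  have hpp : p ≠ 0 := NeZero.ne p
  have hp1 : 1 ≤ p := (Fact.out : p.Prime).one_lt.le
  have h0 : (p : cycloField p) ≠ 0 := by exact_mod_cast hpp
  have hass : Associated (zetaSubOne p ^ (p - 1))
      (p : NumberField.RingOfIntegers (cycloField p)) :=
    IsCyclotomicExtension.Rat.associated_zeta_sub_one_pow_prime p (zetaK_isPrimitiveRoot p)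
  obtain ⟨u, hu⟩ := hass
  have hu1 : (primeAbove p).intValuation
      (u : NumberField.RingOfIntegers (cycloField p)) = 1 := by
    have h2 : (primeAbove p).intValuation (u : NumberField.RingOfIntegers (cycloField p)) *
        (primeAbove p).intValuation
          ((u⁻¹ : (NumberField.RingOfIntegers (cycloField p))ˣ) :
            NumberField.RingOfIntegers (cycloField p)) = 1 := by
      rw [← map_mul, Units.mul_inv, map_one]
    refine le_antisymm ((primeAbove p).intValuation_le_one _) ?_
    rw [← h2]
    exact mul_le_of_le_one_right' ((primeAbove p).intValuation_le_one _)
  have hv : (primeAbove p).valuation (cycloField p) (p : cycloField p) =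
      WithZero.exp (-1 : ℤ) ^ (p - 1) := by
    have h3 : (p : cycloField p) =
        algebraMap (NumberField.RingOfIntegers (cycloField p)) (cycloField p) p := by simp
    rw [h3, IsDedekindDomain.HeightOneSpectrum.valuation_of_algebraMap, ← hu, map_mul, map_pow,
      hu1, mul_one,
      IsDedekindDomain.HeightOneSpectrum.intValuation_singleton _ (zetaSubOne_prime p).ne_zero rfl]
  change valPFun p (p : cycloField p) = 1
  rw [valPFun_of_ne_zero p h0, hv, WithZero.log_pow, WithZero.log_exp, ← WithTop.coe_one]
  congr 1
  rw [nsmul_eq_mul, Nat.cast_sub hp1]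
  push_cast
  field_simp

theorem zetaSubOne_dvd (p : ℕ) [Fact p.Prime] :
    zetaSubOne p ∣ (p : NumberField.RingOfIntegers (cycloField p)) := by
  have hass : Associated (zetaSubOne p ^ (p - 1))
      (p : NumberField.RingOfIntegers (cycloField p)) :=
    IsCyclotomicExtension.Rat.associated_zeta_sub_one_pow_prime p (zetaK_isPrimitiveRoot p)
  exact (dvd_pow_self _ (Nat.sub_ne_zero_of_lt (Fact.out : p.Prime).one_lt)).trans hass.dvd

theorem valP_natCast_of_not_dvd (p : ℕ) [Fact p.Prime] {m : ℕ} (hm : ¬ p ∣ m) :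
    valP p (m : cycloField p) = 0 := by
  have hm0 : (m : cycloField p) ≠ 0 := by
    rintro h
    have h1 : m = 0 := by exact_mod_cast h
    exact hm (h1 ▸ dvd_zero p)
  have hnot : (m : NumberField.RingOfIntegers (cycloField p)) ∉ (primeAbove p).asIdeal := by
    intro hmem
    have hco : IsCoprime (m : ℤ) (p : ℤ) :=
      Nat.isCoprime_iff_coprime.mpr (((Fact.out : p.Prime).coprime_iff_not_dvd.mpr hm).symm)
    obtain ⟨a, b, hab⟩ := hco
    have h1 : (a : NumberField.RingOfIntegers (cycloField p)) * m + b * p = 1 := by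
      exact_mod_cast congrArg (Int.cast : ℤ → NumberField.RingOfIntegers (cycloField p)) hab
    have hpm : (p : NumberField.RingOfIntegers (cycloField p)) ∈ (primeAbove p).asIdeal :=
      Ideal.mem_span_singleton.mpr (zetaSubOne_dvd p)
    refine (primeAbove p).isPrime.ne_top ((Ideal.eq_top_iff_one _).mpr ?_)
    rw [← h1]
    exact add_mem (Ideal.mul_mem_left _ _ hmem) (Ideal.mul_mem_left _ _ hpm)
  have hv : (primeAbove p).valuation (cycloField p) (m : cycloField p) = 1 := by
    have h3 : (m : cycloField p) =
        algebraMap (NumberField.RingOfIntegers (cycloField p)) (cycloField p) m := by simp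
    rw [h3, IsDedekindDomain.HeightOneSpectrum.valuation_of_algebraMap]
    exact IsDedekindDomain.HeightOneSpectrum.intValuation_eq_one_iff.mpr hnot
  change valPFun p (m : cycloField p) = 0
  rw [valPFun_of_ne_zero p hm0, hv]
  simp

theorem valP_natCast (p : ℕ) [Fact p.Prime] {m : ℕ} (hm : m ≠ 0) :
    valP p (m : cycloField p) = ((padicValNat p m : ℚ) : WithTop ℚ) := by
  obtain ⟨k, m', hm', rfl⟩ := Nat.exists_eq_pow_mul_and_not_dvd hm p (Fact.out : p.Prime).ne_one
  have hm'0 : m' ≠ 0 := by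
    rintro rfl
    exact hm' (dvd_zero p)
  rw [Nat.cast_mul, Nat.cast_pow, AddValuation.map_mul, AddValuation.map_pow,
    valP_natCast_self,
    valP_natCast_of_not_dvd p hm', padicValNat.mul (pow_ne_zero _ (NeZero.ne p)) hm'0,
    padicValNat.prime_pow, padicValNat.eq_zero_of_not_dvd hm']
  simp

/-- `valP p` extends the `p`-adic valuation of `ℚ`. -/
theorem valP_ratCast (p : ℕ) [Fact p.Prime] {r : ℚ} (hr : r ≠ 0) :
    valP p (r : cycloField p) = ((padicValRat p r : ℚ) : WithTop ℚ) := by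
  have hn : r.num.natAbs ≠ 0 := by simpa using hr
  have hd : r.den ≠ 0 := r.den_nz
  have hmul : valP p (r : cycloField p) + valP p (r.den : cycloField p) =
      valP p (r.num.natAbs : cycloField p) := by
    rw [← AddValuation.map_mul]
    have h1 : (r : cycloField p) * (r.den : cycloField p) = (r.num : cycloField p) := by
      exact_mod_cast congrArg (Rat.cast : ℚ → cycloField p) (Rat.mul_den_eq_num r)
    rw [h1]
    rcases Int.natAbs_eq r.num with h | h
    · conv_lhs => rw [h]
      simp
    · conv_lhs => rw [h]
      simp
  rw [valP_natCast p hn, valP_natCast p hd] at hmul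
  have hfin : valP p (r : cycloField p) ≠ ⊤ := by
    intro h
    rw [h, top_add] at hmul
    exact WithTop.coe_ne_top hmul.symm
  obtain ⟨t, ht⟩ := WithTop.ne_top_iff_exists.mp hfin
  rw [← ht, ← WithTop.coe_add, WithTop.coe_inj] at hmul
  rw [← ht, WithTop.coe_inj, padicValRat_def, padicValInt]
  rw [Int.cast_sub, Int.cast_natCast, Int.cast_natCast]
  linarith

/-- The canonical additive character `ψ(x) = e^{2πi Tr(x)/p}` of `F`, where `Tr` is the
absolute trace `F → 𝔽_p`. -/
noncomputable def canonicalChar (p : ℕ) [Fact p.Prime] (F : Type*) [Field F] [Fintype F]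
    [Algebra (ZMod p) F] : AddChar F ℂ :=
  (ZMod.stdAddChar (N := p)).compAddMonoidHom (Algebra.trace (ZMod p) F).toAddMonoidHom

theorem canonicalChar_apply (p : ℕ) [Fact p.Prime] (F : Type*) [Field F] [Fintype F]
    [Algebra (ZMod p) F] (x : F) :
    canonicalChar p F x =
      Complex.exp (2 * Real.pi * Complex.I * (Algebra.trace (ZMod p) F x).val / p) := by
  have h := ZMod.stdAddChar_coe (N := p) ((Algebra.trace (ZMod p) F x).val : ℤ)
  rw [Int.cast_natCast, ZMod.natCast_zmod_val] at h
  simpa [canonicalChar] using h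

/-- The Weil sum `W_{F,d}(a) = ∑_{x ∈ F} ψ(x^d - a x)`. -/
noncomputable def weilSum (p : ℕ) [Fact p.Prime] (F : Type*) [Field F] [Fintype F]
    [Algebra (ZMod p) F] (d : ℕ) (a : F) : ℂ :=
  ∑ x : F, canonicalChar p F (x ^ d - a * x)

theorem weilSum_mem (p : ℕ) [Fact p.Prime] (F : Type*) [Field F] [Fintype F]
    [Algebra (ZMod p) F] (d : ℕ) (a : F) : weilSum p F d a ∈ cycloField p := by
  refine sum_mem fun x _ => ?_
  have h : canonicalChar p F (x ^ d - a * x) =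
      zetaP p ^ (Algebra.trace (ZMod p) F (x ^ d - a * x)).val := by
    rw [canonicalChar_apply, zetaP, ← Complex.exp_nat_mul]
    congr 1
    ring
  rw [h]
  exact pow_mem (IntermediateField.mem_adjoin_simple_self ℚ (zetaP p)) _

/-- `V_{F,d} = min_{a ∈ F} val_p(W_{F,d}(a))`. -/
noncomputable def weilVal (p : ℕ) [Fact p.Prime] (F : Type*) [Field F] [Fintype F]
    [Algebra (ZMod p) F] (d : ℕ) : WithTop ℚ :=
  Finset.univ.inf fun a : F => valP p ⟨weilSum p F d a, weilSum_mem p F d a⟩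

/-- `d` is degenerate over the finite field `K` of characteristic `p`: it is congruent to a power
of `p` modulo `|K| - 1`. -/
def IsDegenerate (p : ℕ) (K : Type*) [Field K] (d : ℕ) : Prop :=
  ∃ k : ℕ, d ≡ p ^ k [MOD Nat.card K - 1]

/-- `d` is a positive integer with `gcd(d, |F| - 1) = 1` that is nondegenerate over `F`, degenerate
over `𝔽_p`, and has `V_{F,d} = v`. -/
structure IsExponentWithVal (p : ℕ) [Fact p.Prime] (F : Type*) [Field F] [Fintype F]
    [Algebra (ZMod p) F] (d : ℕ) (v : ℚ) : Prop where
  pos : 0 < d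
  gcd_eq_one : Nat.gcd d (Fintype.card F - 1) = 1
  nondegenerate : ¬ IsDegenerate p F d
  degenerate_prime : IsDegenerate p (ZMod p) d
  val_eq : weilVal p F d = (v : WithTop ℚ)

/-!
Let `K` be the subfield of `F` of order `Q = p ^ (n / ℓ)`, so that `F` has odd degree `ℓ` over `K`.
For each of the exponents `d` every square `W(a) ^ 2` of a Weil sum is `0` or a power `Q ^ e` with
`e ≥ ℓ + 1`, and `Q ^ (ℓ + 1)` occurs (`HasMinimalSquare`). As `Q = p ^ (n / ℓ)`, the minimal
valuation is `(ℓ + 1) / 2 * (n / ℓ)`. Degenerate exponents only have the Weil sums `0` and `|F|`, so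
nondegeneracy follows as well (`HasMinimalSquare.isExponentWithVal`). All the exponents are odd, so
the Weil sums are real and their squares are squared absolute values.

The Weil sums become exponential sums of the quadratic forms
`y ↦ Tr(y ^ (Q ^ i + 1) - b y ^ (Q ^ j + 1))` on the `K`-space `F` (`frobForm`), with
`(i, j) = (1, 0)` for `d = Q + 1` and `p = 2`, with `(3, 1)` for `d = Q ^ 2 - Q + 1`, and with
`(2, 0)` for `d = (Q ^ 2 + 1) / 2`. In the last two cases one substitutes
`x = c y ^ (Q ^ j + 1)` with `c ∈ Kˣ`, and `W(a)` is the mean over `c` of the sums of the form scaled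
by `c` (`card_units_mul_weilSum`).

The squared absolute value of the sum of a quadratic form is `|F|` times a sum over the radical of
its polar form (`quadSum_mul_conj`).

* If `p` is odd, diagonalization (`exists_rank_quadSum`) shows that scaling by a nonsquare multiplies
  the sum by `(-1) ^ r`, where `r` is the rank, and that the squared absolute value is
  `Q ^ (2 ℓ - r)`. Thus `W(a) = 0` if `r` is odd. The radical is the kernel of a polynomial in the
  Frobenius, and it has dimension at most two (`natCard_radical_frobForm_two_zero_le`,
  `natCard_radical_frobForm_three_one_le`), so an even `r` equals `ℓ - 1`. Not all Weil sums vanish,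
  as their sum is `|F|`.
* If `p = 2`, the polar form is alternating on a space of odd dimension, so its radical is nonzero
  (`exists_ne_zero_of_isAlt_of_odd_finrank`), and the sum over the radical is `0` or its order. For
  `a = 1` the radical is `K`, and the quadratic form vanishes on it.
-/

/-! ### Exponential sums of quadratic forms over finite fields -/

theorem AddChar.map_finsetSum_eq_prod {A M ι : Type*} [AddCommMonoid A] [CommMonoid M]
    (ψ : AddChar A M) (s : Finset ι) (f : ι → A) : ψ (∑ i ∈ s, f i) = ∏ i ∈ s, ψ (f i) := by
  classical
  induction s using Finset.induction_on with
  | empty => simp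
  | insert i s hi ih => rw [Finset.sum_insert hi, Finset.prod_insert hi, map_add_eq_mul, ih]

section QuadraticSums

variable {K V : Type*} [Field K] [Fintype K] [AddCommGroup V] [Module K V] [Fintype V]

open scoped ComplexConjugate

/-- The exponential sum `∑ ψ(f(x))` of a quadratic form `f` over a finite field. -/
noncomputable def quadSum (ψ : AddChar K ℂ) (f : QuadraticForm K V) : ℂ := ∑ x, ψ (f x)

omit [Fintype K] in
open Classical in
theorem sum_addChar_linearMap {ψ : AddChar K ℂ} (hψ : ψ ≠ 1) (φ : V →ₗ[K] K) :
    ∑ y, ψ (φ y) = if φ = 0 then (Fintype.card V : ℂ) else 0 := by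
  have h := AddChar.sum_eq_ite (ψ.compAddMonoidHom φ.toAddMonoidHom)
  simp only [AddChar.compAddMonoidHom_apply, LinearMap.toAddMonoidHom_coe] at h
  rw [h]
  congr 1
  rw [eq_iff_iff]
  constructor
  · intro h0
    by_contra hφ
    obtain ⟨c, hc⟩ := AddChar.ne_one_iff.mp hψ
    obtain ⟨y, hy⟩ := LinearMap.surjective hφ c
    exact hc (by simpa [hy] using DFunLike.congr_fun h0 y)
  · rintro rfl
    ext y
    simp

open Classical in
/-- The squared absolute value of a quadratic sum is a sum over the radical of the polar form. -/
theorem quadSum_mul_conj {ψ : AddChar K ℂ} (hψ : ψ ≠ 1) (f : QuadraticForm K V) :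
    quadSum ψ f * conj (quadSum ψ f) =
      Fintype.card V * ∑ z with f.polarBilin z = 0, ψ (f z) := by
  have h1 : quadSum ψ f * conj (quadSum ψ f) = ∑ z, ∑ y, ψ (f (z + y)) * ψ (-f y) := by
    rw [quadSum, map_sum, Finset.sum_mul_sum, Finset.sum_comm]
    conv_rhs => rw [Finset.sum_comm]
    refine Finset.sum_congr rfl fun y _ => ?_
    refine Fintype.sum_equiv (Equiv.subRight y) _ _ fun x => ?_
    simp [AddChar.map_neg_eq_conj]
  have h2 : ∀ z, ∑ y, ψ (f (z + y)) * ψ (-f y) =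
      ψ (f z) * if f.polarBilin z = 0 then (Fintype.card V : ℂ) else 0 := by
    intro z
    rw [← sum_addChar_linearMap hψ, Finset.mul_sum]
    refine Finset.sum_congr rfl fun y _ => ?_
    rw [← AddChar.map_add_eq_mul, ← AddChar.map_add_eq_mul]
    congr 1
    simp only [QuadraticMap.polarBilin_apply_apply, QuadraticMap.polar]
    ring
  rw [h1, Finset.sum_congr rfl fun z _ => h2 z, Finset.mul_sum, Finset.sum_filter]
  refine Finset.sum_congr rfl fun z _ => ?_
  split_ifs <;> ring

theorem quadSum_mul_conj_of_two_ne_zero {ψ : AddChar K ℂ} (hψ : ψ ≠ 1) (h2 : (2 : K) ≠ 0)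
    (f : QuadraticForm K V) :
    quadSum ψ f * conj (quadSum ψ f) =
      Fintype.card V * Nat.card {z // f.polarBilin z = 0} := by
  classical
  rw [quadSum_mul_conj hψ, Nat.card_eq_fintype_card, Fintype.card_subtype, Finset.card_eq_sum_ones,
    Nat.cast_sum]
  congr 1
  refine Finset.sum_congr rfl fun z hz => ?_
  have h := LinearMap.congr_fun (Finset.mem_filter.mp hz).2 z
  rw [QuadraticMap.polarBilin_apply_apply, QuadraticMap.polar_self] at h
  have h0 : f z = 0 := by simpa [h2] using h
  simp [h0]

/-- The one-variable quadratic exponential sum `∑ ψ(w x²)`. -/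
noncomputable def sqSum (ψ : AddChar K ℂ) (w : K) : ℂ := ∑ x : K, ψ (w * x ^ 2)

theorem sqSum_eq_gaussSum [DecidableEq K] {ψ : AddChar K ℂ} (hψ : ψ ≠ 1) (h2 : (2 : K) ≠ 0)
    {w : K} (hw : w ≠ 0) :
    sqSum ψ w = gaussSum ((quadraticChar K).ringHomComp (Int.castRingHom ℂ)) (ψ.mulShift w) := by
  have hK : ringChar K ≠ 2 := by
    intro h
    apply h2
    have := ringChar.Nat.cast_ringChar (R := K)
    rw [h] at this
    exact_mod_cast this
  have h1 : sqSum ψ w = ∑ a : K, ((quadraticChar K a : ℂ) + 1) * ψ (w * a) := by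
    rw [sqSum, ← Finset.sum_fiberwise_of_maps_to (g := fun x : K => x ^ 2)
      (fun x _ => Finset.mem_univ _)]
    refine Finset.sum_congr rfl fun a _ => ?_
    have h3 : ∀ x ∈ ({x ∈ Finset.univ | x ^ 2 = a} : Finset K), ψ (w * x ^ 2) = ψ (w * a) := by
      intro x hx
      rw [(Finset.mem_filter.mp hx).2]
    rw [Finset.sum_congr rfl h3, Finset.sum_const, nsmul_eq_mul]
    congr 1
    have h4 := quadraticChar_card_sqrts hK a
    have h5 : ({x | x ^ 2 = a} : Set K).toFinset = ({x ∈ Finset.univ | x ^ 2 = a} : Finset K) := by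
      ext; simp
    rw [h5] at h4
    exact_mod_cast congrArg (Int.cast : ℤ → ℂ) h4
  have h6 : ∑ a : K, ψ (w * a) = 0 := by
    have := sum_addChar_linearMap hψ (LinearMap.mulLeft K w)
    simp only [LinearMap.mulLeft_apply] at this
    rw [this, if_neg]
    intro h
    exact hw (by simpa using LinearMap.congr_fun h 1)
  rw [h1, gaussSum]
  simp only [add_mul, Finset.sum_add_distrib, one_mul, h6, add_zero]
  simp

theorem sqSum_mul [DecidableEq K] {ψ : AddChar K ℂ} (hψ : ψ ≠ 1) (h2 : (2 : K) ≠ 0)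
    {c w : K} (hc : c ≠ 0) (hw : w ≠ 0) :
    sqSum ψ (c * w) = (quadraticChar K c : ℂ) * sqSum ψ w := by
  rw [sqSum_eq_gaussSum hψ h2 (mul_ne_zero hc hw), sqSum_eq_gaussSum hψ h2 hw,
    ← gaussSum_mulShift _ (ψ.mulShift w) (Units.mk0 c hc), AddChar.mulShift_mulShift]
  have h : (quadraticChar K c : ℂ) * (quadraticChar K c : ℂ) = 1 := by
    have := quadraticChar_sq_one hc
    rw [sq] at this
    exact_mod_cast this
  simp only [MulChar.ringHomComp_apply, Units.val_mk0, eq_intCast]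
  rw [← mul_assoc, h, one_mul, mul_comm c w]

theorem sqSum_mul_conj {ψ : AddChar K ℂ} (hψ : ψ ≠ 1) (h2 : (2 : K) ≠ 0) {w : K} (hw : w ≠ 0) :
    sqSum ψ w * conj (sqSum ψ w) = Fintype.card K := by
  have h := quadSum_mul_conj_of_two_ne_zero hψ h2 (w • QuadraticMap.sq : QuadraticForm K K)
  have h1 : quadSum ψ (w • QuadraticMap.sq : QuadraticForm K K) = sqSum ψ w := by
    simp [quadSum, sqSum, sq]
  have h3 : Nat.card {z // (w • QuadraticMap.sq : QuadraticForm K K).polarBilin z = 0} = 1 := by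
    rw [Nat.card_eq_one_iff_exists]
    refine ⟨⟨0, by simp⟩, fun z => Subtype.ext ?_⟩
    have hz := LinearMap.congr_fun z.2 1
    simp only [QuadraticMap.polarBilin_apply_apply, QuadraticMap.polar, smul_apply,
      QuadraticMap.sq_apply, smul_eq_mul, LinearMap.zero_apply] at hz
    have : w * 2 * z.1 = 0 := by linear_combination hz
    simpa [hw, h2] using this
  rwa [h1, h3, Nat.cast_one, mul_one] at h

/-- Diagonalising a quadratic form `f` of rank `r` in odd characteristic gives the absolute value of
its sum, and shows that scaling `f` by a nonsquare changes the sum by the factor `(-1) ^ r`. -/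
theorem exists_rank_quadSum [DecidableEq K] {ψ : AddChar K ℂ} (hψ : ψ ≠ 1) (h2 : (2 : K) ≠ 0)
    (f : QuadraticForm K V) :
    ∃ r ≤ Module.finrank K V,
      (∀ c : K, c ≠ 0 → quadSum ψ (c • f) = (quadraticChar K c : ℂ) ^ r * quadSum ψ f) ∧
      quadSum ψ f * conj (quadSum ψ f) =
        (Fintype.card K : ℂ) ^ (2 * Module.finrank K V - r) := by
  let : Invertible (2 : K) := invertibleOfNonzero h2
  obtain ⟨w, ⟨e⟩⟩ := QuadraticForm.equivalent_weightedSumSquares f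
  have hprod : ∀ c : K, quadSum ψ (c • f) = ∏ i, sqSum ψ (c * w i) := by
    intro c
    rw [quadSum, ← e.toLinearEquiv.symm.toEquiv.sum_comp]
    simp only [sqSum]
    rw [Finset.prod_univ_sum, Fintype.piFinset_univ]
    refine Finset.sum_congr rfl fun x _ => ?_
    rw [← AddChar.map_finsetSum_eq_prod]
    congr 1
    have h : f (e.toLinearEquiv.symm x) = QuadraticMap.weightedSumSquares K w x := by
      rw [← e.map_app]
      congr 1
      exact e.toLinearEquiv.apply_symm_apply x
    rw [smul_apply]
    change c • f (e.toLinearEquiv.symm x) = _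
    rw [h, QuadraticMap.weightedSumSquares_apply, Finset.smul_sum]
    refine Finset.sum_congr rfl fun i _ => ?_
    simp only [smul_eq_mul]
    ring
  have hzero : sqSum ψ 0 = Fintype.card K := by simp [sqSum]
  have hone : quadSum ψ f = ∏ i, sqSum ψ (w i) := by simpa using hprod 1
  have hcount : ∀ t : ℂ, ∏ i, (if w i = 0 then (1 : ℂ) else t) =
      t ^ (Finset.univ.filter fun i => w i ≠ 0).card := by
    intro t
    rw [Finset.prod_ite]
    simp
  refine ⟨(Finset.univ.filter fun i => w i ≠ 0).card, ?_, ?_, ?_⟩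
  · simpa using (Finset.card_filter_le Finset.univ fun i => w i ≠ 0)
  · intro c hc
    rw [hprod, hone, ← hcount, ← Finset.prod_mul_distrib]
    refine Finset.prod_congr rfl fun i _ => ?_
    split_ifs with hi
    · rw [hi, mul_zero, one_mul]
    · exact sqSum_mul hψ h2 hc hi
  · rw [hone, map_prod, ← Finset.prod_mul_distrib]
    have h3 : ∀ i, sqSum ψ (w i) * conj (sqSum ψ (w i)) =
        if w i = 0 then (Fintype.card K : ℂ) ^ 2 else (Fintype.card K : ℂ) := by
      intro i
      split_ifs with hi
      · rw [hi, hzero]; simp [sq]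
      · exact sqSum_mul_conj hψ h2 hi
    simp only [h3, Finset.prod_ite, Finset.prod_const]
    rw [← pow_mul, ← pow_add]
    congr 1
    have := Finset.card_filter_add_card_filter_not (s := Finset.univ) (fun i => w i = 0)
    simp only [Finset.card_univ, Fintype.card_fin] at this
    simp only [ne_eq]
    omega

end QuadraticSums

/-! ### Alternating forms on odd-dimensional spaces in characteristic two -/

section Alternating

/-- Pairing each permutation with its inverse cancels the terms of the determinant; the involutions
that are left have a fixed point, where the diagonal of the matrix contributes a zero factor. -/
theorem Matrix.det_eq_zero_of_symm_of_diag_eq_zero {ι R : Type*} [Fintype ι] [DecidableEq ι]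
    [CommRing R] [CharP R 2] (hι : Odd (Fintype.card ι)) (M : Matrix ι ι R)
    (hsymm : ∀ i j, M i j = M j i) (hdiag : ∀ i, M i i = 0) : M.det = 0 := by
  rw [Matrix.det_apply]
  refine Finset.sum_involution (fun σ _ => σ⁻¹) ?_ ?_ (fun _ _ => Finset.mem_univ _)
    (fun σ _ => inv_inv σ)
  · intro σ _
    have h : ∏ i, M (σ⁻¹ i) i = ∏ i, M (σ i) i := by
      rw [← Equiv.prod_comp σ]
      refine Finset.prod_congr rfl fun i _ => ?_
      rw [Equiv.Perm.inv_def, Equiv.symm_apply_apply, hsymm]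
    rw [Equiv.Perm.sign_inv, h]
    exact CharTwo.add_self_eq_zero _
  · intro σ _ hσ hinv
    apply hσ
    have h2 : σ ^ 2 ^ 1 = 1 := by
      rw [pow_one, sq]
      nth_rewrite 1 [← hinv]
      exact inv_mul_cancel σ
    have : Fact (Nat.Prime 2) := ⟨Nat.prime_two⟩
    obtain ⟨i, hi⟩ := Equiv.Perm.exists_fixed_point_of_prime (p := 2) (n := 1)
      (by rw [← even_iff_two_dvd]; exact Nat.not_even_iff_odd.mpr hι) h2
    rw [Finset.prod_eq_zero (Finset.mem_univ i) (by rw [hi, hdiag]), smul_zero]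

theorem exists_ne_zero_of_isAlt_of_odd_finrank {K V : Type*} [Field K] [CharP K 2]
    [AddCommGroup V] [Module K V] [FiniteDimensional K V] (hV : Odd (Module.finrank K V))
    (B : LinearMap.BilinForm K V) (hB : B.IsAlt) : ∃ z ≠ 0, B z = 0 := by
  by_contra! h
  have hnd : B.Nondegenerate := by
    refine (hB.isRefl.nondegenerate_iff_separatingLeft).mpr fun z hz => ?_
    by_contra h0
    exact h z h0 (LinearMap.ext hz)
  let b := Module.finBasis K V
  refine (LinearMap.BilinForm.nondegenerate_iff_det_ne_zero b).mp hnd ?_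
  refine Matrix.det_eq_zero_of_symm_of_diag_eq_zero (by simpa using hV) _ ?_ ?_
  · intro i j
    rw [LinearMap.BilinForm.toMatrix_apply, LinearMap.BilinForm.toMatrix_apply]
    exact (CharTwo.neg_eq _).symm.trans (hB.neg_eq _ _)
  · intro i
    rw [LinearMap.BilinForm.toMatrix_apply, hB.self_eq_zero]

end Alternating

/-! ### Quadratic sums in characteristic two -/

section EvenCharacteristic

open scoped ComplexConjugate

/-- In characteristic two `ψ ∘ f` is a character of the radical, and in odd dimension the radical of
the alternating polar form is nonzero. -/
theorem quadSum_mul_conj_of_odd_finrank {K V : Type*} [Field K] [Fintype K] [CharP K 2]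
    [AddCommGroup V] [Module K V] [Fintype V] {ψ : AddChar K ℂ} (hψ : ψ ≠ 1)
    (hV : Odd (Module.finrank K V)) (f : QuadraticForm K V) :
    quadSum ψ f * conj (quadSum ψ f) = 0 ∨
      ∃ e, Module.finrank K V + 1 ≤ e ∧
        quadSum ψ f * conj (quadSum ψ f) = (Fintype.card K : ℂ) ^ e := by
  classical
  have hadd : ∀ a b : LinearMap.ker f.polarBilin, f (a + b) = f a + f b := by
    intro a b
    have h := LinearMap.congr_fun (LinearMap.mem_ker.mp a.2) (b : V)
    rw [QuadraticMap.polarBilin_apply_apply, QuadraticMap.polar, LinearMap.zero_apply] at h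
    linear_combination h
  let χ : AddChar (LinearMap.ker f.polarBilin) ℂ :=
    { toFun := fun z => ψ (f z)
      map_zero_eq_one' := by simp
      map_add_eq_mul' := fun a b => by
        rw [Submodule.coe_add, hadd, AddChar.map_add_eq_mul] }
  have hsum : ∑ z with f.polarBilin z = 0, ψ (f z) = ∑ z, χ z :=
    Finset.sum_subtype _ (fun z => by simp [LinearMap.mem_ker]) _
  rw [quadSum_mul_conj hψ, hsum, AddChar.sum_eq_ite]
  split_ifs
  · right
    refine ⟨Module.finrank K V + Module.finrank K (LinearMap.ker f.polarBilin), ?_, ?_⟩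
    · obtain ⟨z, hz0, hz⟩ := exists_ne_zero_of_isAlt_of_odd_finrank hV f.polarBilin (fun z => by
        rw [QuadraticMap.polarBilin_apply_apply, QuadraticMap.polar_self, two_smul]
        exact CharTwo.add_self_eq_zero _)
      have : Nontrivial (LinearMap.ker f.polarBilin) :=
        ⟨⟨⟨z, LinearMap.mem_ker.mpr hz⟩, 0, fun h => hz0 (congrArg Subtype.val h)⟩⟩
      have := Module.finrank_pos (R := K) (M := LinearMap.ker f.polarBilin)
      omega
    · rw [Module.card_eq_pow_finrank (K := K) (V := V),
        Module.card_eq_pow_finrank (K := K) (V := LinearMap.ker f.polarBilin)]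
      push_cast
      rw [pow_add]
  · left
    rw [mul_zero]

end EvenCharacteristic

/-! ### Quadratic forms built from the Frobenius, and their radicals -/

section FrobeniusForms

variable (K F : Type*) [Field K] [Fintype K] [Field F] [Fintype F] [Algebra K F]

/-- The generator `x ↦ x ^ |K|` of the Galois group of `F / K`. -/
noncomputable abbrev frob : Gal(F/K) := FiniteField.frobeniusAlgEquivOfAlgebraic K F

variable {K F}

theorem frob_pow_apply (i : ℕ) (x : F) : (frob K F ^ i) x = x ^ Fintype.card K ^ i := by
  rw [AlgEquiv.coe_pow, FiniteField.coe_frobeniusAlgEquivOfAlgebraic_iterate]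

theorem frob_pow_finrank : frob K F ^ Module.finrank K F = 1 := by
  rw [← FiniteField.orderOf_frobeniusAlgEquivOfAlgebraic]
  exact pow_orderOf_eq_one _

theorem mem_range_algebraMap_of_frob_eq {x : F} (hx : frob K F x = x) :
    x ∈ Set.range (algebraMap K F) := by
  rw [IsGalois.mem_range_algebraMap_iff_fixed]
  intro f
  obtain ⟨n, rfl⟩ := (FiniteField.bijective_frobeniusAlgEquivOfAlgebraic_pow K F).2 f
  change (frob K F ^ (n : ℕ)) x = x
  rw [AlgEquiv.coe_pow]
  exact Function.iterate_fixed hx n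

theorem natCard_fixed_frob : Nat.card {x : F // frob K F x = x} = Fintype.card K := by
  rw [← Nat.card_eq_fintype_card]
  refine (Nat.card_congr (Equiv.ofBijective
    (fun c : K => (⟨algebraMap K F c, (frob K F).commutes c⟩ : {x : F // frob K F x = x}))
    ⟨fun a b h => (algebraMap K F).injective (congrArg Subtype.val h), fun x => ?_⟩)).symm
  obtain ⟨c, hc⟩ := mem_range_algebraMap_of_frob_eq x.2
  exact ⟨c, Subtype.ext hc⟩

/-- The Galois group has odd order, so an element and its square fix the same points. -/
theorem fixed_of_sq_fixed (hodd : Odd (Module.finrank K F)) {g : Gal(F/K)} {i : ℕ}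
    (hg : g = frob K F ^ i) {x : F} (hx : g (g x) = x) : g x = x := by
  obtain ⟨t, ht⟩ := hodd
  have h1 : (g ^ Module.finrank K F) x = x := by
    rw [hg, ← pow_mul, mul_comm, pow_mul, frob_pow_finrank, one_pow, AlgEquiv.one_apply]
  have h2 : (((g ^ 2) ^ t) : Gal(F/K)) x = x := by
    rw [AlgEquiv.coe_pow]
    refine Function.iterate_fixed ?_ t
    rw [sq, AlgEquiv.mul_apply, hx]
  rw [ht, pow_succ', pow_mul, AlgEquiv.mul_apply, h2] at h1
  exact h1

theorem eq_zero_of_frob_eq_neg (h2 : (2 : F) ≠ 0) (hodd : Odd (Module.finrank K F)) {x : F}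
    (hx : frob K F x = -x) : x = 0 := by
  have h : frob K F x = x :=
    fixed_of_sq_fixed hodd (i := 1) (pow_one _).symm (by rw [hx, map_neg, hx, neg_neg])
  have h3 : 2 * x = 0 := by linear_combination hx - h
  exact (mul_eq_zero.mp h3).resolve_left h2

/-- The quadratic form `y ↦ Tr(y ^ (Q ^ i + 1) - b y ^ (Q ^ j + 1))` on the `K`-space `F`, where
`Q = |K|`. -/
noncomputable def frobForm (i j : ℕ) (b : F) : QuadraticForm K F :=
  LinearMap.BilinMap.toQuadraticMap
    (((LinearMap.mul K F).compl₂ (frob K F ^ i).toLinearMap -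
      b • (LinearMap.mul K F).compl₂ (frob K F ^ j).toLinearMap).compr₂ (Algebra.trace K F))

theorem frobForm_apply (i j : ℕ) (b y : F) :
    frobForm i j b y = Algebra.trace K F (y ^ (Fintype.card K ^ i + 1) -
      b * y ^ (Fintype.card K ^ j + 1)) := by
  simp [frobForm, frob_pow_apply, pow_succ']

theorem trace_frob_pow (i : ℕ) (x : F) :
    Algebra.trace K F ((frob K F ^ i) x) = Algebra.trace K F x :=
  Algebra.trace_eq_of_algEquiv _ x

/-- The radical of `frobForm i j b` is the kernel of a polynomial in the Frobenius: the polar form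
is made linear in a single conjugate of `y` by the invariance of the trace. -/
theorem polarBilin_frobForm_eq_zero_iff {i j : ℕ} (hij : j ≤ i) (b z : F) :
    (frobForm (K := K) i j b).polarBilin z = 0 ↔
      z + (frob K F ^ (2 * i)) z =
        (frob K F ^ (i - j)) (b * z) + (frob K F ^ i) (b * (frob K F ^ j) z) := by
  set w : F := z + (frob K F ^ (2 * i)) z -
    ((frob K F ^ (i - j)) (b * z) + (frob K F ^ i) (b * (frob K F ^ j) z)) with hw
  have key : ∀ y, (frobForm (K := K) i j b).polarBilin z y =
      Algebra.trace K F ((frob K F ^ i) y * w) := by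
    intro y
    have h1 : Algebra.trace K F (y * (frob K F ^ i) z) =
        Algebra.trace K F ((frob K F ^ i) y * (frob K F ^ (2 * i)) z) := by
      rw [← trace_frob_pow i, map_mul, two_mul, pow_add, AlgEquiv.mul_apply]
    have h2 : Algebra.trace K F (b * (z * (frob K F ^ j) y)) =
        Algebra.trace K F ((frob K F ^ i) y * (frob K F ^ (i - j)) (b * z)) := by
      rw [← trace_frob_pow (i - j), ← mul_assoc, map_mul, ← AlgEquiv.mul_apply, ← pow_add,
        Nat.sub_add_cancel hij, mul_comm]
    have h3 : Algebra.trace K F (b * (y * (frob K F ^ j) z)) =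
        Algebra.trace K F ((frob K F ^ i) y * (frob K F ^ i) (b * (frob K F ^ j) z)) := by
      rw [← trace_frob_pow i, ← map_mul]
      congr 2
      ring
    have h4 : (frobForm (K := K) i j b).polarBilin z y =
        Algebra.trace K F (z * (frob K F ^ i) y - b * (z * (frob K F ^ j) y)) +
        Algebra.trace K F (y * (frob K F ^ i) z - b * (y * (frob K F ^ j) z)) := by
      simp [frobForm, LinearMap.BilinMap.polarBilin_toQuadraticMap]
    rw [h4, map_sub, map_sub, h1, h2, h3, hw, mul_sub, mul_add, mul_add, map_sub, map_add, map_add,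
      mul_comm z]
    ring
  rw [← sub_eq_zero (b := _ + _), ← hw]
  constructor
  · intro h
    refine (traceForm_nondegenerate K F).2 w fun x => ?_
    obtain ⟨y, rfl⟩ := (frob K F ^ i).surjective x
    rw [Algebra.traceForm_apply, ← key, h, LinearMap.zero_apply]
  · intro h
    ext y
    rw [key, h, mul_zero, map_zero, LinearMap.zero_apply]

/-- A counting criterion: `P` defines a set with at most `|K| ^ 2` elements if, for a fixed nonzero
`y` in it, some function `w y` from it to `K` has fibres that lie in translates of the line `K y`. -/
theorem natCard_le_sq_of_fixed_pairing {P : F → Prop} (w : F → F → F)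
    (hw : ∀ y z, P y → P z → frob K F (w y z) = w y z)
    (hinj : ∀ y z z', y ≠ 0 → P y → P z → P z' → w y z = w y z' →
      frob K F ((z - z') / y) = (z - z') / y) :
    Nat.card {z // P z} ≤ Fintype.card K ^ 2 := by
  classical
  by_cases hP : ∃ y, y ≠ 0 ∧ P y
  · obtain ⟨y, hy, hPy⟩ := hP
    have hK : (Finset.univ.filter fun x : F => frob K F x = x).card = Fintype.card K := by
      rw [← natCard_fixed_frob (K := K) (F := F), Nat.card_eq_fintype_card, Fintype.card_subtype]
    rw [Nat.card_eq_fintype_card, Fintype.card_subtype, sq]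
    have himg : ((Finset.univ.filter P).image (w y)).card ≤ Fintype.card K := by
      rw [← hK]
      refine Finset.card_le_card fun c hc => ?_
      obtain ⟨z, hz, rfl⟩ := Finset.mem_image.mp hc
      simpa using hw y z hPy (Finset.mem_filter.mp hz).2
    refine (Finset.card_le_mul_card_image _ (Fintype.card K) ?_).trans
      (Nat.mul_le_mul_left _ himg)
    intro c hc
    obtain ⟨z', hz', rfl⟩ := Finset.mem_image.mp hc
    rw [← hK]
    refine Finset.card_le_card_of_injOn (fun z => (z - z') / y) ?_ ?_
    · intro z hz
      have hz1 := Finset.mem_filter.mp hz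
      exact Finset.mem_coe.mpr (Finset.mem_filter.mpr ⟨Finset.mem_univ _,
        hinj y z z' hy hPy (Finset.mem_filter.mp hz1.1).2 (Finset.mem_filter.mp hz').2 hz1.2⟩)
    · intro z _ z1 _ h
      simpa [div_left_inj' hy] using h
  · push Not at hP
    have : Nat.card {z // P z} ≤ 1 := by
      rw [Finite.card_le_one_iff_subsingleton]
      refine ⟨fun a b => Subtype.ext ?_⟩
      have h : ∀ c : {z // P z}, c.1 = 0 := fun c => by
        by_contra h0
        exact hP c h0 c.2
      rw [h a, h b]
    exact this.trans (Nat.one_le_pow _ _ Fintype.card_pos)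

/-- For `(i, j) = (2, 0)` the radical is the solution space of a second order recurrence, in which
the Wronskian of two elements lies in `K`. -/
theorem natCard_radical_frobForm_two_zero_le (hodd : Odd (Module.finrank K F)) (b : F) :
    Nat.card {z // (frobForm (K := K) 2 0 b).polarBilin z = 0} ≤ Fintype.card K ^ 2 := by
  refine natCard_le_sq_of_fixed_pairing
    (fun y z => y * (frob K F ^ 2) z - z * (frob K F ^ 2) y) ?_ ?_
  · intro y z hy hz
    rw [polarBilin_frobForm_eq_zero_iff (Nat.zero_le _)] at hy hz
    have h2 : (frob K F ^ (2 * 2) : Gal(F/K)) = frob K F ^ 2 * frob K F ^ 2 := by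
      rw [← pow_add]
    simp only [h2, Nat.sub_zero, pow_zero, AlgEquiv.one_apply, AlgEquiv.mul_apply, map_mul]
      at hy hz
    apply fixed_of_sq_fixed hodd (i := 1) (pow_one _).symm
    rw [← AlgEquiv.mul_apply, ← sq, map_sub, map_mul, map_mul]
    linear_combination (frob K F ^ 2) y * hz - (frob K F ^ 2) z * hy
  · intro y z z' hy _ _ _ h
    have hy2 : (frob K F ^ 2) y ≠ 0 := by simpa using hy
    apply fixed_of_sq_fixed hodd (i := 1) (pow_one _).symm
    rw [← AlgEquiv.mul_apply, ← sq, map_div₀, map_sub, div_eq_div_iff hy2 hy]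
    linear_combination h

/-- For `(i, j) = (3, 1)` the radical is the solution space of a recurrence of order three in
`frob ^ 2`. A nonzero solution `y` determines `b`, and after the substitution `z = t y` the recurrence
factors: it says that a second order expression in `t` is fixed by `frob ^ 2`. That expression
vanishes only if `t` lies in `K`, so the radical has dimension at most two. -/
theorem natCard_radical_frobForm_three_one_le (h2 : (2 : F) ≠ 0)
    (hodd : Odd (Module.finrank K F)) (b : F) :
    Nat.card {z // (frobForm (K := K) 3 1 b).polarBilin z = 0} ≤ Fintype.card K ^ 2 := by
  have hrad : ∀ z : F, (frobForm (K := K) 3 1 b).polarBilin z = 0 ↔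
      z + (frob K F ^ 6) z = (frob K F ^ 2) b * (frob K F ^ 2) z +
        (frob K F ^ 3) b * (frob K F ^ 4) z := by
    intro z
    rw [polarBilin_frobForm_eq_zero_iff (by norm_num), map_mul, map_mul, ← AlgEquiv.mul_apply _ _ z,
      ← pow_add]
  set s : F → F := fun x => frob K F x with hsdef
  have hpow : ∀ (i : ℕ) (x : F), (frob K F ^ (i + 1)) x = s ((frob K F ^ i) x) := by
    intro i x
    rw [pow_succ', AlgEquiv.mul_apply]
  have hsmul : ∀ x y, s (x * y) = s x * s y := map_mul (frob K F)
  have hsadd : ∀ x y, s (x + y) = s x + s y := map_add (frob K F)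
  have hssub : ∀ x y, s (x - y) = s x - s y := map_sub (frob K F)
  have hsdiv : ∀ x y, s (x / y) = s x / s y := map_div₀ (frob K F)
  have hs0 : ∀ x, s x = 0 ↔ x = 0 := fun x => map_eq_zero (frob K F)
  simp only [hpow, pow_zero, AlgEquiv.one_apply] at hrad
  simp only [hrad]
  refine natCard_le_sq_of_fixed_pairing (fun y z =>
    s y * s (s (s (s y))) * (s (s (s (s (z / y)))) - s (s (z / y))) +
      y * s (s (s y)) * (s (s (z / y)) - z / y)) ?_ ?_
  · intro y z hy hz
    apply fixed_of_sq_fixed hodd (i := 1) (pow_one _).symm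
    by_cases hy0 : y = 0
    · simp [hy0, hsdef]
    obtain ⟨t, rfl⟩ : ∃ t, z = t * y := ⟨z / y, by field_simp⟩
    rw [mul_div_cancel_right₀ _ hy0]
    change s (s _) = _
    -- a nonzero `y` in the radical determines `b`, because `1 + frob` is injective
    have hD : s (s b) * s (s y) * s (s (s y)) - (y * s (s (s y)) - s y * s (s (s (s y))) +
        s (s y) * s (s (s (s (s y))))) = 0 := by
      refine eq_zero_of_frob_eq_neg (K := K) h2 hodd ?_
      change s _ = _
      simp only [hsmul, hsadd, hssub]
      linear_combination (-s (s (s y))) * hy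
    have hD1 := congrArg s hD
    rw [(hs0 0).mpr rfl] at hD1
    simp only [hsmul, hsadd, hssub] at hD1 hz ⊢
    linear_combination s (s (s y)) * hz + s (s t) * hD + s (s (s (s t))) * hD1
  · intro y z z' hy _ _ _ h
    obtain ⟨t, rfl⟩ : ∃ t, z = t * y := ⟨z / y, by field_simp⟩
    obtain ⟨t', rfl⟩ : ∃ t, z' = t * y := ⟨z' / y, by field_simp⟩
    rw [← sub_mul, mul_div_cancel_right₀ _ hy]
    simp only [mul_div_cancel_right₀ _ hy] at h
    set δ := t - t' with hδ
    have hρ : y * s (s (s y)) * ((s (s δ) - δ) * s (s (s δ) - δ)) = 0 := by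
      refine eq_zero_of_frob_eq_neg (K := K) h2 hodd ?_
      change s _ = _
      simp only [hδ, hsmul, hssub]
      linear_combination (s (s (s t)) - s (s (s t')) - (s t - s t')) * h
    have hy3 : y * s (s (s y)) ≠ 0 := by simp [hs0, hy]
    have h0 : s (s δ) - δ = 0 := by
      rcases mul_eq_zero.mp ((mul_eq_zero.mp hρ).resolve_left hy3) with h | h
      · exact h
      · exact (hs0 _).mp h
    exact fixed_of_sq_fixed hodd (i := 1) (pow_one _).symm (sub_eq_zero.mp h0)

theorem polarBilin_frobForm_one_zero_one_eq_zero_iff [CharP F 2] (hodd : Odd (Module.finrank K F))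
    (z : F) : (frobForm (K := K) 1 0 1).polarBilin z = 0 ↔ frob K F z = z := by
  rw [polarBilin_frobForm_eq_zero_iff (Nat.zero_le _)]
  simp only [Nat.sub_zero, one_mul, pow_zero, AlgEquiv.one_apply, CharTwo.add_self_eq_zero,
    CharTwo.add_eq_zero, pow_one, mul_one, sq, AlgEquiv.mul_apply]
  exact ⟨fun h => fixed_of_sq_fixed hodd (i := 1) (pow_one _).symm h.symm,
    fun h => by rw [h, h]⟩

theorem polarBilin_frobForm_three_one_one_eq_zero_iff [CharP F 2]
    (hodd : Odd (Module.finrank K F)) (z : F) :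
    (frobForm (K := K) 3 1 1).polarBilin z = 0 ↔ frob K F z = z := by
  rw [polarBilin_frobForm_eq_zero_iff (by norm_num), one_mul, one_mul]
  constructor
  · intro h
    have h6 : (frob K F ^ (2 * 3) : Gal(F/K)) = frob K F ^ 2 * (frob K F ^ 2 * frob K F ^ 2) := by
      rw [← pow_add, ← pow_add]
    have h4 : (frob K F ^ 3) ((frob K F ^ 1) z) = (frob K F ^ 2) ((frob K F ^ 2) z) := by
      rw [← AlgEquiv.mul_apply, ← AlgEquiv.mul_apply, ← pow_add, ← pow_add]
    rw [h4, h6, AlgEquiv.mul_apply, AlgEquiv.mul_apply] at h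
    set g : Gal(F/K) := frob K F ^ 2 with hg
    have hd4 : g (g (g z - z)) = g z - z := by
      rw [map_sub, map_sub]
      linear_combination h
    have hd2 : g (g z - z) = g z - z := fixed_of_sq_fixed hodd hg hd4
    have hz4 : g (g z) = z := by
      rw [map_sub] at hd2
      linear_combination hd2 + CharTwo.add_self_eq_zero (g z) - CharTwo.add_self_eq_zero z
    have hz2 : g z = z := fixed_of_sq_fixed hodd hg hz4
    rw [hg, sq, AlgEquiv.mul_apply] at hz2
    exact fixed_of_sq_fixed hodd (i := 1) (pow_one _).symm hz2
  · intro h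
    have hi : ∀ i, (frob K F ^ i) z = z := fun i => by
      rw [AlgEquiv.coe_pow]
      exact Function.iterate_fixed h i
    simp only [hi]

/-- Norms show that every nonzero `x` is a scalar times an `e`-th power, when the norm is the power
map with an exponent congruent to `1` modulo `e`. -/
theorem exists_units_mul_pow_eq {e t : ℕ}
    (ht : ∑ k ∈ Finset.range (Module.finrank K F), Fintype.card K ^ k = 1 + t * e) (x : Fˣ) :
    ∃ (c : Kˣ) (y : Fˣ), Units.map (algebraMap K F).toMonoidHom c * y ^ e = x := by
  refine ⟨Units.map (Algebra.norm K) x, (x ^ t)⁻¹, Units.ext ?_⟩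
  have h : algebraMap K F (Algebra.norm K (x : F)) = (x : F) ^ (1 + t * e) := by
    rw [FiniteField.algebraMap_norm_eq_pow, ← ht, Nat.geomSum_eq Fintype.one_lt_card,
      ← Module.card_eq_pow_finrank, Nat.card_eq_fintype_card, Nat.card_eq_fintype_card]
  have hx := x.ne_zero
  simp only [Units.val_mul, Units.coe_map, Units.val_pow_eq_pow_val, Units.val_inv_eq_inv_val]
  change algebraMap K F (Algebra.norm K (x : F)) * _ = _
  rw [h, inv_pow, ← pow_mul, pow_add, pow_one, mul_assoc, mul_inv_cancel₀ (pow_ne_zero _ hx),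
    mul_one]

end FrobeniusForms

/-! ### Weil sums -/

section WeilSums

open scoped ComplexConjugate

theorem stdAddChar_zmod_ne_one (p : ℕ) [Fact p.Prime] : ZMod.stdAddChar (N := p) ≠ 1 := by
  rw [AddChar.ne_one_iff]
  refine ⟨1, fun h => one_ne_zero (α := ZMod p) (ZMod.injective_stdAddChar ?_)⟩
  rw [h, AddChar.map_zero_eq_one]

variable (p : ℕ) [Fact p.Prime] (F : Type*) [Field F] [Fintype F] [Algebra (ZMod p) F]

theorem canonicalChar_ne_one : canonicalChar p F ≠ 1 := by
  obtain ⟨c, hc⟩ := AddChar.ne_one_iff.mp (stdAddChar_zmod_ne_one p)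
  obtain ⟨x, rfl⟩ := Algebra.trace_surjective (ZMod p) F c
  exact AddChar.ne_one_iff.mpr ⟨x, hc⟩

variable {F}

theorem canonicalChar_pow_prime_pow (k : ℕ) (x : F) :
    canonicalChar p F (x ^ p ^ k) = canonicalChar p F x := by
  have h := trace_frob_pow (K := ZMod p) k x
  rw [frob_pow_apply, ZMod.card] at h
  change ZMod.stdAddChar (Algebra.trace (ZMod p) F (x ^ p ^ k)) = _
  rw [h]
  rfl

theorem sum_canonicalChar_mul [DecidableEq F] (b : F) :
    ∑ x : F, canonicalChar p F (b * x) = if b = 0 then (Fintype.card F : ℂ) else 0 := by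
  have h := sum_addChar_linearMap (canonicalChar_ne_one p F) (LinearMap.mulLeft F b)
  simp only [LinearMap.mulLeft_apply] at h
  simpa using h

theorem sum_weilSum {d : ℕ} (hd : 0 < d) : ∑ a : F, weilSum p F d a = Fintype.card F := by
  classical
  have h1 : ∀ a x : F, canonicalChar p F (x ^ d - a * x) =
      canonicalChar p F (x ^ d) * canonicalChar p F (-x * a) := by
    intro a x
    rw [← AddChar.map_add_eq_mul]
    congr 1
    ring
  simp only [weilSum, h1]
  rw [Finset.sum_comm]
  simp only [← Finset.mul_sum, sum_canonicalChar_mul]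
  simp [hd.ne']

theorem conj_weilSum {d : ℕ} (hd : Odd d) (a : F) :
    conj (weilSum p F d a) = weilSum p F d a := by
  rw [weilSum, map_sum, ← Equiv.sum_comp (Equiv.neg F)]
  refine Finset.sum_congr rfl fun x _ => ?_
  rw [← AddChar.map_neg_eq_conj, Equiv.neg_apply, hd.neg_pow]
  congr 1
  ring

theorem weilSum_of_modEq_prime_pow {d k : ℕ} (hd : 0 < d)
    (hdk : d ≡ p ^ k [MOD Fintype.card F - 1]) (a : F) :
    weilSum p F d a = 0 ∨ weilSum p F d a = Fintype.card F := by
  classical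
  have hpow : ∀ x : F, x ^ d = x ^ p ^ k := by
    intro x
    by_cases hx : x = 0
    · rw [hx, zero_pow hd.ne', zero_pow (pow_ne_zero _ (NeZero.ne p))]
    · exact pow_eq_pow_of_modEq hdk (FiniteField.pow_card_sub_one_eq_one x hx)
  have h : weilSum p F d a = ∑ x : F, canonicalChar p F ((1 - a) * x) := by
    refine Finset.sum_congr rfl fun x _ => ?_
    rw [AddChar.map_sub_eq_div, hpow, canonicalChar_pow_prime_pow, ← AddChar.map_sub_eq_div]
    congr 1
    ring
  rw [h, sum_canonicalChar_mul]
  split_ifs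
  · exact Or.inr rfl
  · exact Or.inl rfl

variable {K : Type*} [Field K] [Fintype K] [Algebra (ZMod p) K] [Algebra K F]
  [IsScalarTower (ZMod p) K F]

theorem canonicalChar_trace (x : F) :
    canonicalChar p K (Algebra.trace K F x) = canonicalChar p F x := by
  change ZMod.stdAddChar (Algebra.trace (ZMod p) K (Algebra.trace K F x)) = _
  rw [Algebra.trace_trace]
  rfl

theorem sum_comp_surjective {G H : Type*} [Group G] [Group H] [Fintype G] [Fintype H] (φ : G →* H)
    (hφ : Function.Surjective φ) (h : H → ℂ) :
    (Fintype.card H : ℂ) * ∑ g, h (φ g) = Fintype.card G * ∑ x, h x := by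
  classical
  set N := (Finset.univ.filter fun g => φ g = 1).card with hN
  have hfib : ∀ x, (Finset.univ.filter fun g => φ g = x).card = N := fun x =>
    MonoidHom.card_fiber_eq_of_mem_range φ (hφ x) (hφ 1)
  have hcard : Fintype.card G = Fintype.card H * N := by
    rw [← Finset.card_univ, Finset.card_eq_sum_card_fiberwise (f := φ) (t := Finset.univ)
      (fun _ _ => Finset.mem_coe.mpr (Finset.mem_univ _))]
    simp [hfib]
  have hsum : ∑ g, h (φ g) = N * ∑ x, h x := by
    rw [← Finset.sum_fiberwise_of_maps_to (g := φ) (t := Finset.univ)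
      (fun _ _ => Finset.mem_univ _), Finset.mul_sum]
    refine Finset.sum_congr rfl fun x _ => ?_
    rw [Finset.sum_congr rfl fun g hg => by rw [(Finset.mem_filter.mp hg).2], Finset.sum_const,
      hfib, nsmul_eq_mul]
  rw [hsum, hcard]
  push_cast
  ring

theorem sum_eq_zero_add_sum_units {R : Type*} [Field R] [Fintype R] [DecidableEq R]
    (h : R → ℂ) :
    ∑ x, h x = h 0 + ∑ u : Rˣ, h u := by
  classical
  rw [← Finset.add_sum_erase _ _ (Finset.mem_univ (0 : R))]
  congr 1
  refine (Finset.sum_bij (fun (u : Rˣ) _ => (u : R)) ?_ ?_ ?_ ?_).symm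
  · intro u _; simp
  · intro u _ v _ h; exact Units.ext h
  · intro x hx
    exact ⟨Units.mk0 x (Finset.ne_of_mem_erase hx), Finset.mem_univ _, rfl⟩
  · intro u _; rfl

/-- Substituting `x = c y ^ (Q ^ j + 1)` with `c ∈ Kˣ` turns a Weil sum into an average of quadratic
exponential sums. -/
theorem card_units_mul_weilSum [DecidableEq K] {d i j t : ℕ}
    (ht : ∑ k ∈ Finset.range (Module.finrank K F), Fintype.card K ^ k =
      1 + t * (Fintype.card K ^ j + 1))
    (hd1 : d ≡ 1 [MOD Fintype.card K - 1])
    (hd : (Fintype.card K ^ j + 1) * d = Fintype.card K ^ i + 1) (a : F) :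
    (Fintype.card Kˣ : ℂ) * weilSum p F d a =
      ∑ c : Kˣ, quadSum (canonicalChar p K) ((c : K) • frobForm i j a) := by
  classical
  have hd0 : d ≠ 0 := by rintro rfl; simp at hd
  have hcd : ∀ c : Kˣ, (c : K) ^ d = c := by
    intro c
    have := pow_eq_pow_of_modEq hd1 (FiniteField.pow_card_sub_one_eq_one (c : K) c.ne_zero)
    rwa [pow_one] at this
  let φ : Kˣ × Fˣ →* Fˣ :=
    { toFun := fun u => Units.map (algebraMap K F).toMonoidHom u.1 * u.2 ^ (Fintype.card K ^ j + 1)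
      map_one' := by simp
      map_mul' := fun u v => by
        rw [Prod.fst_mul, Prod.snd_mul, map_mul, mul_pow, mul_mul_mul_comm] }
  have hφ : Function.Surjective φ := fun x => by
    obtain ⟨c, y, h⟩ := exists_units_mul_pow_eq ht x
    exact ⟨(c, y), h⟩
  have hterm : ∀ (c : Kˣ) (y : F),
      canonicalChar p K (((c : K) • frobForm i j a : QuadraticForm K F) y) =
      canonicalChar p F ((algebraMap K F c * y ^ (Fintype.card K ^ j + 1)) ^ d -
        a * (algebraMap K F c * y ^ (Fintype.card K ^ j + 1))) := by
    intro c y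
    rw [smul_apply, frobForm_apply, ← map_smul, canonicalChar_trace]
    congr 1
    rw [mul_pow, ← pow_mul, hd, ← map_pow, hcd, Algebra.smul_def]
    ring
  have hH := sum_comp_surjective φ hφ
    (fun x => canonicalChar p F ((x : F) ^ d - a * x))
  have hF : (Fintype.card Fˣ : ℂ) ≠ 0 := Nat.cast_ne_zero.mpr Fintype.card_ne_zero
  have hH2 : ∑ g, canonicalChar p F ((φ g : F) ^ d - a * φ g) =
      Fintype.card Kˣ * ∑ x : Fˣ, canonicalChar p F ((x : F) ^ d - a * x) := by
    apply mul_left_cancel₀ hF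
    rw [hH, Fintype.card_prod]
    push_cast
    ring
  have hq : ∀ c : Kˣ, quadSum (canonicalChar p K) ((c : K) • frobForm i j a) =
      1 + ∑ y : Fˣ, canonicalChar p F ((φ (c, y) : F) ^ d - a * φ (c, y)) := by
    intro c
    rw [quadSum, sum_eq_zero_add_sum_units]
    congr 1
    · simp
    · exact Finset.sum_congr rfl fun y _ => hterm c y
  rw [weilSum, sum_eq_zero_add_sum_units, zero_pow hd0, mul_zero, sub_zero,
    AddChar.map_zero_eq_one, mul_add, ← hH2, Fintype.sum_prod_type]
  simp only [hq, Finset.sum_add_distrib]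
  simp

omit [IsScalarTower (ZMod p) K F] in
/-- In odd characteristic the sums of odd rank cancel in the average over `Kˣ`, and those of even
rank agree; a radical of dimension at most two then leaves a single absolute value. -/
theorem weilSum_eq_zero_or_sq_eq_of_two_ne_zero [DecidableEq K] {d i j : ℕ} {a : F}
    (h2 : (2 : K) ≠ 0)
    (hodd : Odd (Module.finrank K F)) (hd : Odd d)
    (hrad : Nat.card {z // (frobForm (K := K) i j a).polarBilin z = 0} ≤ Fintype.card K ^ 2)
    (hW : (Fintype.card Kˣ : ℂ) * weilSum p F d a =
      ∑ c : Kˣ, quadSum (canonicalChar p K) ((c : K) • frobForm i j a)) :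
    weilSum p F d a = 0 ∨
      weilSum p F d a ^ 2 = (Fintype.card K : ℂ) ^ (Module.finrank K F + 1) := by
  classical
  have hψ := canonicalChar_ne_one p K
  obtain ⟨r, hr, hscale, habs⟩ :=
    exists_rank_quadSum hψ h2 (frobForm (K := K) i j a)
  have hK : (Fintype.card Kˣ : ℂ) ≠ 0 := Nat.cast_ne_zero.mpr Fintype.card_ne_zero
  have hQ : 1 < Fintype.card K := Fintype.one_lt_card
  have hchar : ringChar K ≠ 2 := by
    intro h
    apply h2
    have := ringChar.Nat.cast_ringChar (R := K)
    rw [h] at this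
    exact_mod_cast this
  have hW' : (Fintype.card Kˣ : ℂ) * weilSum p F d a =
      (∑ c : Kˣ, (quadraticChar K (c : K) : ℂ) ^ r) *
        quadSum (canonicalChar p K) (frobForm i j a) := by
    rw [hW, Finset.sum_mul]
    exact Finset.sum_congr rfl fun c _ => hscale c c.ne_zero
  have hsq : ∀ c : Kˣ, (quadraticChar K (c : K) : ℂ) ^ 2 = 1 := fun c => by
    exact_mod_cast quadraticChar_sq_one c.ne_zero
  rcases Nat.even_or_odd' r with ⟨s, rfl | rfl⟩
  · right
    simp only [pow_mul, hsq, one_pow, Finset.sum_const, Finset.card_univ, nsmul_eq_mul,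
      mul_one] at hW'
    have hWS := mul_left_cancel₀ hK hW'
    have h3 := quadSum_mul_conj_of_two_ne_zero hψ h2 (frobForm (K := K) i j a)
    rw [habs, Module.card_eq_pow_finrank (K := K) (V := F)] at h3
    have h4 : Fintype.card K ^ (2 * Module.finrank K F - 2 * s) ≤
        Fintype.card K ^ (Module.finrank K F + 2) := by
      have h5 : Fintype.card K ^ (2 * Module.finrank K F - 2 * s) =
          Fintype.card K ^ Module.finrank K F *
            Nat.card {z // (frobForm (K := K) i j a).polarBilin z = 0} := by
        exact_mod_cast h3
      rw [h5, pow_add]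
      exact Nat.mul_le_mul_left _ hrad
    have h6 := (Nat.pow_le_pow_iff_right hQ).mp h4
    obtain ⟨l, hl⟩ := hodd
    have h7 : 2 * Module.finrank K F - 2 * s = Module.finrank K F + 1 := by omega
    rw [← h7, ← habs, ← hWS, conj_weilSum p hd, sq]
  · left
    have h0 : ∑ c : Kˣ, (quadraticChar K (c : K) : ℂ) ^ (2 * s + 1) = 0 := by
      simp only [pow_add, pow_mul, hsq, one_pow, one_mul, pow_one]
      have h := quadraticChar_sum_zero hchar
      have h1 := sum_eq_zero_add_sum_units fun x : K => (quadraticChar K x : ℂ)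
      rw [← Int.cast_sum, h] at h1
      simpa using h1.symm
    rw [h0, zero_mul] at hW'
    exact (mul_eq_zero.mp hW').resolve_left hK

/-- The property of an exponent `d` that determines its Weil valuation, where `|F| = Q ^ ℓ`: the
squares of the Weil sums are `0` or powers of `Q` with exponent at least `ℓ + 1`, and
`Q ^ (ℓ + 1)` occurs. -/
def HasMinimalSquare (F : Type*) [Field F] [Fintype F] [Algebra (ZMod p) F] (Q ℓ d : ℕ) : Prop :=
  (∀ a : F, weilSum p F d a = 0 ∨ ∃ e, ℓ + 1 ≤ e ∧ weilSum p F d a ^ 2 = (Q : ℂ) ^ e) ∧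
    ∃ a : F, weilSum p F d a ^ 2 = (Q : ℂ) ^ (ℓ + 1)

/-- The value `Q ^ (ℓ + 1)` is attained because the Weil sums add up to `|F|`, so that they do not all
vanish. -/
theorem hasMinimalSquare_of_two_ne_zero {d i j t : ℕ} (h2 : (2 : K) ≠ 0)
    (hodd : Odd (Module.finrank K F)) (hd : Odd d)
    (hrad : ∀ a : F,
      Nat.card {z // (frobForm (K := K) i j a).polarBilin z = 0} ≤ Fintype.card K ^ 2)
    (ht : ∑ k ∈ Finset.range (Module.finrank K F), Fintype.card K ^ k =
      1 + t * (Fintype.card K ^ j + 1))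
    (hd1 : d ≡ 1 [MOD Fintype.card K - 1])
    (hdij : (Fintype.card K ^ j + 1) * d = Fintype.card K ^ i + 1) :
    HasMinimalSquare p F (Fintype.card K) (Module.finrank K F) d := by
  classical
  have key := fun a : F => weilSum_eq_zero_or_sq_eq_of_two_ne_zero p h2 hodd hd (hrad a)
    (card_units_mul_weilSum p ht hd1 hdij a)
  refine ⟨fun a => (key a).imp_right fun h => ⟨_, le_rfl, h⟩, ?_⟩
  by_contra! h
  have h0 : ∀ a : F, weilSum p F d a = 0 := fun a => (key a).resolve_right (h a)
  have hs := sum_weilSum p (F := F) hd.pos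
  simp only [h0, Finset.sum_const_zero] at hs
  exact Fintype.card_ne_zero (Nat.cast_eq_zero.mp hs.symm)

omit [IsScalarTower (ZMod p) K F] in
/-- In characteristic two the value `Q ^ (ℓ + 1)` is attained at `a = 1`: there the radical is `K`,
and the quadratic form vanishes on it. -/
theorem hasMinimalSquare_of_charTwo [CharP K 2] {d i j : ℕ} (hodd : Odd (Module.finrank K F))
    (hd : Odd d) (b : F → F) (hb : b 1 = 1)
    (hrad : ∀ z : F, (frobForm (K := K) i j 1).polarBilin z = 0 ↔ frob K F z = z)
    (hW : ∀ a, weilSum p F d a = quadSum (canonicalChar p K) (frobForm i j (b a))) :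
    HasMinimalSquare p F (Fintype.card K) (Module.finrank K F) d := by
  classical
  have hψ := canonicalChar_ne_one p K
  have hsq : ∀ a, weilSum p F d a ^ 2 = quadSum (canonicalChar p K) (frobForm i j (b a)) *
      conj (quadSum (canonicalChar p K) (frobForm i j (b a))) := by
    intro a
    rw [← hW, conj_weilSum p hd, sq]
  refine ⟨fun a => ?_, 1, ?_⟩
  · refine (quadSum_mul_conj_of_odd_finrank hψ hodd (frobForm i j (b a))).imp (fun h => ?_)
      (fun ⟨e, he, h⟩ => ⟨e, he, (hsq a).trans h⟩)
    exact pow_eq_zero_iff two_ne_zero |>.mp ((hsq a).trans h)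
  · have hone : ∀ z ∈ (Finset.univ.filter fun z : F =>
        (frobForm (K := K) i j 1).polarBilin z = 0),
        canonicalChar p K (frobForm i j 1 z) = 1 := by
      intro z hz
      have hfix : z ^ Fintype.card K = z := (hrad z).mp (Finset.mem_filter.mp hz).2
      have hpow : ∀ m, z ^ Fintype.card K ^ m = z := by
        intro m
        induction m with
        | zero => simp
        | succ m ih => rw [pow_succ, pow_mul, ih, hfix]
      rw [frobForm_apply, pow_succ, pow_succ, hpow, hpow, one_mul, sub_self, map_zero,
        AddChar.map_zero_eq_one]
    rw [hsq, hb, quadSum_mul_conj hψ, Finset.sum_congr rfl hone, Finset.sum_const, nsmul_eq_mul,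
      mul_one]
    simp only [hrad]
    rw [← Fintype.card_subtype, ← Nat.card_eq_fintype_card (α := {z : F // frob K F z = z}),
      natCard_fixed_frob, Module.card_eq_pow_finrank (K := K) (V := F), pow_succ]
    push_cast
    rfl

end WeilSums

/-! ### The three exponents -/

section Exponents

variable (p : ℕ) [Fact p.Prime] {F : Type*} [Field F] [Fintype F] [Algebra (ZMod p) F]
  {K : Type*} [Field K] [Fintype K] [Algebra (ZMod p) K] [Algebra K F]
  [IsScalarTower (ZMod p) K F]

theorem exists_geom_sum_eq_one_add_mul {Q e ℓ : ℕ} (hℓ : Odd ℓ) (he : e ∣ Q + 1) :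
    ∃ t, ∑ k ∈ Finset.range ℓ, Q ^ k = 1 + t * e := by
  obtain ⟨u, rfl⟩ := hℓ
  obtain ⟨v, hv⟩ := he
  induction u with
  | zero => exact ⟨0, by simp⟩
  | succ u ih =>
    obtain ⟨t, ht⟩ := ih
    refine ⟨t + Q ^ (2 * u + 1) * v, ?_⟩
    rw [show 2 * (u + 1) + 1 = 2 * u + 1 + 1 + 1 by ring, Finset.sum_range_succ,
      Finset.sum_range_succ, ht, pow_succ Q (2 * u + 1)]
    linear_combination Q ^ (2 * u + 1) * hv

theorem coprime_pow_sub_one_of_dvd_pow_add_one {Q d ℓ s : ℕ} (hQ : 0 < Q) (hℓ : Odd ℓ) (hd : Odd d)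
    (hds : d ∣ Q ^ s + 1) : Nat.gcd d (Q ^ ℓ - 1) = 1 := by
  have h1 : Nat.gcd d (Q ^ ℓ - 1) ∣ Q ^ (s * ℓ) + 1 := by
    refine (Nat.gcd_dvd_left _ _).trans (hds.trans ?_)
    have := hℓ.nat_add_dvd_pow_add_pow (Q ^ s) 1
    rwa [one_pow, ← pow_mul] at this
  have h2 : Nat.gcd d (Q ^ ℓ - 1) ∣ Q ^ (s * ℓ) - 1 := by
    refine (Nat.gcd_dvd_right _ _).trans ?_
    rw [mul_comm, pow_mul]
    exact Nat.sub_one_dvd_pow_sub_one _ _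
  have hpos : 1 ≤ Q ^ (s * ℓ) := Nat.one_le_pow _ _ hQ
  have h3 : Nat.gcd d (Q ^ ℓ - 1) ∣ 2 := by
    have := Nat.dvd_sub h1 h2
    rwa [show Q ^ (s * ℓ) + 1 - (Q ^ (s * ℓ) - 1) = 2 by omega] at this
  rcases (Nat.dvd_prime Nat.prime_two).mp h3 with h | h
  · exact h
  · exact absurd (hd.of_dvd_nat (Nat.gcd_dvd_left _ _)) (by rw [h]; decide)

theorem hasMinimalSquare_add_one [CharP K 2] (hp : p = 2) (hodd : Odd (Module.finrank K F))
    (hQ : Even (Fintype.card K)) :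
    HasMinimalSquare p F (Fintype.card K) (Module.finrank K F) (Fintype.card K + 1) := by
  have : CharP F 2 := charP_of_injective_algebraMap (algebraMap K F).injective 2
  refine hasMinimalSquare_of_charTwo (K := K) (i := 1) (j := 0) p hodd hQ.add_one
    (fun a => a ^ 2) (one_pow 2) (polarBilin_frobForm_one_zero_one_eq_zero_iff hodd) fun a => ?_
  refine Finset.sum_congr rfl fun x _ => ?_
  -- the linear term `a x` may be squared, since the absolute trace is invariant under squaring
  have hx : (a * x) ^ p ^ 1 = a ^ 2 * x ^ (Fintype.card K ^ 0 + 1) := by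
    rw [show p ^ 1 = 2 by rw [hp, pow_one], pow_zero, mul_pow]
  rw [frobForm_apply, canonicalChar_trace, AddChar.map_sub_eq_div, AddChar.map_sub_eq_div,
    ← canonicalChar_pow_prime_pow p 1 (a * x), hx, pow_one]

omit [Fintype K] in
theorem quadSum_smul_of_isSquare {V : Type*} [AddCommGroup V] [Module K V] [Fintype V]
    (ψ : AddChar K ℂ) (f : QuadraticForm K V) (c : Kˣ) (hc : IsSquare (c : K)) :
    quadSum ψ ((c : K) • f) = quadSum ψ f := by
  obtain ⟨u, hu⟩ := hc
  have hu0 : u ≠ 0 := by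
    rintro rfl
    exact c.ne_zero (by rw [hu, mul_zero])
  refine Fintype.sum_equiv (LinearEquiv.smulOfNeZero K V u hu0).toEquiv _ _ fun x => ?_
  change _ = ψ (f (u • x))
  rw [smul_apply, QuadraticMap.map_smul, hu]

theorem hasMinimalSquare_sq_sub_add_one (hodd : Odd (Module.finrank K F)) :
    HasMinimalSquare p F (Fintype.card K) (Module.finrank K F)
      (Fintype.card K ^ 2 - Fintype.card K + 1) := by
  classical
  obtain ⟨u, hu⟩ : ∃ u, Fintype.card K = u + 1 := Nat.exists_eq_succ_of_ne_zero Fintype.card_ne_zero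
  have hdu : Fintype.card K ^ 2 - Fintype.card K + 1 = 1 + u * (u + 1) := by
    rw [hu, show (u + 1) ^ 2 = u * (u + 1) + (u + 1) by ring, Nat.add_sub_cancel, add_comm]
  rw [hdu]
  have hd : Odd (1 + u * (u + 1)) := by
    rw [add_comm]
    exact (Nat.even_mul_succ_self u).add_one
  obtain ⟨t, ht⟩ := exists_geom_sum_eq_one_add_mul (Q := Fintype.card K)
    (e := Fintype.card K ^ 1 + 1) hodd (by rw [pow_one])
  have hd1 : 1 + u * (u + 1) ≡ 1 [MOD Fintype.card K - 1] := by
    rw [hu, Nat.add_sub_cancel]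
    simp [Nat.ModEq]
  have hdij : (Fintype.card K ^ 1 + 1) * (1 + u * (u + 1)) = Fintype.card K ^ 3 + 1 := by
    rw [hu]
    ring
  by_cases h2 : (2 : K) = 0
  · have hK2 : CharP K 2 := CharTwo.of_one_ne_zero_of_two_eq_zero one_ne_zero h2
    have : CharP F 2 := charP_of_injective_algebraMap (algebraMap K F).injective 2
    refine hasMinimalSquare_of_charTwo (K := K) (i := 3) (j := 1) p hodd hd id rfl
      (polarBilin_frobForm_three_one_one_eq_zero_iff hodd) fun a => ?_
    have h := card_units_mul_weilSum p ht hd1 hdij a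
    have hsq : ∀ c : Kˣ, quadSum (canonicalChar p K) ((c : K) • frobForm 3 1 a) =
        quadSum (canonicalChar p K) (frobForm (F := F) 3 1 a) := fun c =>
      quadSum_smul_of_isSquare _ _ c
        (FiniteField.isSquare_of_char_two (CharP.eq K (ringChar.charP K) hK2) (c : K))
    simp only [hsq, Finset.sum_const, Finset.card_univ, nsmul_eq_mul] at h
    exact mul_left_cancel₀ (Nat.cast_ne_zero.mpr Fintype.card_ne_zero) h
  · have h2F : (2 : F) ≠ 0 := fun h =>
      h2 ((algebraMap K F).injective (by rw [map_ofNat, h, map_zero]))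
    exact hasMinimalSquare_of_two_ne_zero p h2 hodd hd
      (natCard_radical_frobForm_three_one_le h2F hodd) ht hd1 hdij

theorem hasMinimalSquare_sq_add_one_div_two (h2 : (2 : K) ≠ 0) (hQ : Odd (Fintype.card K))
    (hodd : Odd (Module.finrank K F)) :
    HasMinimalSquare p F (Fintype.card K) (Module.finrank K F)
      ((Fintype.card K ^ 2 + 1) / 2) := by
  obtain ⟨u, hu⟩ := hQ
  have hdu : (Fintype.card K ^ 2 + 1) / 2 = 2 * (u * (u + 1)) + 1 := by
    rw [hu, show (2 * u + 1) ^ 2 + 1 = 2 * (2 * (u * (u + 1)) + 1) by ring,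
      Nat.mul_div_cancel_left _ two_pos]
  rw [hdu]
  obtain ⟨t, ht⟩ := exists_geom_sum_eq_one_add_mul (Q := Fintype.card K)
    (e := Fintype.card K ^ 0 + 1) hodd (by rw [hu]; exact ⟨u + 1, by ring⟩)
  refine hasMinimalSquare_of_two_ne_zero (i := 2) p h2 hodd ⟨_, rfl⟩
    (natCard_radical_frobForm_two_zero_le hodd) ht ?_ ?_
  · rw [hu, Nat.add_sub_cancel, ← mul_assoc, add_comm]
    simp [Nat.ModEq]
  · rw [hu]
    ring

/-! ### Valuations of the Weil sums -/

theorem valP_eq_of_sq_eq {x : cycloField p} {k : ℕ} (hx : x ^ 2 = (p : cycloField p) ^ k) :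
    valP p x = ((k / 2 : ℚ) : WithTop ℚ) := by
  have h := congrArg (valP p) hx
  rw [AddValuation.map_pow, AddValuation.map_pow, valP_natCast_self] at h
  cases hv : valP p x with
  | top =>
    rw [hv, two_nsmul, top_add, ← WithTop.coe_one, ← WithTop.coe_nsmul] at h
    exact absurd h.symm WithTop.coe_ne_top
  | coe v =>
    rw [hv, ← WithTop.coe_one, ← WithTop.coe_nsmul, ← WithTop.coe_nsmul, WithTop.coe_inj,
      nsmul_eq_mul, nsmul_eq_mul] at h
    rw [WithTop.coe_inj]
    push_cast at h
    linarith

theorem valP_weilSum_eq_of_sq_eq {d k : ℕ} {a : F} (h : weilSum p F d a ^ 2 = (p : ℂ) ^ k) :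
    valP p ⟨weilSum p F d a, weilSum_mem p F d a⟩ = ((k / 2 : ℚ) : WithTop ℚ) := by
  refine valP_eq_of_sq_eq p (Subtype.ext ?_)
  push_cast
  exact h

/-- Nondegeneracy comes for free: the Weil sums of a degenerate exponent are `0` or `|F|`, and the
square of the latter is not `Q ^ (ℓ + 1)`. -/
theorem HasMinimalSquare.isExponentWithVal {m ℓ s d : ℕ} (hm : 0 < m) (hℓ : Odd ℓ) (hℓ1 : 1 < ℓ)
    (hF : Fintype.card F = p ^ (m * ℓ)) (h : HasMinimalSquare p F (p ^ m) ℓ d) (hd : Odd d)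
    (hds : d ∣ (p ^ m) ^ s + 1) (hd1 : d ≡ 1 [MOD p - 1]) :
    IsExponentWithVal p F d (((ℓ : ℚ) + 1) * (m * ℓ : ℕ) / (2 * ℓ)) := by
  have hp : p.Prime := Fact.out
  have hv : ((ℓ : ℚ) + 1) * (m * ℓ : ℕ) / (2 * ℓ) = ((m * (ℓ + 1) : ℕ) : ℚ) / 2 := by
    have : (ℓ : ℚ) ≠ 0 := by positivity
    push_cast
    field_simp
  have hpow : ∀ e : ℕ, ((p ^ m : ℕ) : ℂ) ^ e = (p : ℂ) ^ (m * e) := fun e => by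
    rw [Nat.cast_pow, pow_mul]
  refine ⟨hd.pos, ?_, ?_, ⟨0, ?_⟩, ?_⟩
  · rw [hF, pow_mul]
    exact coprime_pow_sub_one_of_dvd_pow_add_one (pow_pos hp.pos m) hℓ hd hds
  · rintro ⟨k, hk⟩
    rw [Nat.card_eq_fintype_card] at hk
    obtain ⟨a, ha⟩ := h.2
    rw [hpow] at ha
    rcases weilSum_of_modEq_prime_pow p hd.pos hk a with h0 | h0
    · rw [h0, zero_pow two_ne_zero] at ha
      exact pow_ne_zero _ (Nat.cast_ne_zero.mpr hp.ne_zero) ha.symm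
    · rw [h0, hF] at ha
      have h1 : p ^ (m * ℓ * 2) = p ^ (m * (ℓ + 1)) := by
        rw [pow_mul]
        exact_mod_cast ha
      have h2 := Nat.pow_right_injective hp.two_le h1
      rw [mul_assoc] at h2
      have h3 := Nat.eq_of_mul_eq_mul_left hm h2
      omega
  · rwa [Nat.card_eq_fintype_card, ZMod.card, pow_zero]
  · rw [hv]
    refine le_antisymm ?_ (Finset.le_inf fun a _ => ?_)
    · obtain ⟨a, ha⟩ := h.2
      rw [hpow] at ha
      rw [← valP_weilSum_eq_of_sq_eq p ha]
      exact Finset.inf_le (Finset.mem_univ a)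
    · rcases h.1 a with h0 | ⟨e, he, h0⟩
      · have : (⟨weilSum p F d a, weilSum_mem p F d a⟩ : cycloField p) = 0 := Subtype.ext h0
        rw [this, AddValuation.map_zero]
        exact le_top
      · rw [hpow] at h0
        rw [valP_weilSum_eq_of_sq_eq p h0, WithTop.coe_le_coe]
        have : ((m * (ℓ + 1) : ℕ) : ℚ) ≤ (m * e : ℕ) :=
          Nat.cast_le.mpr (Nat.mul_le_mul_left m he)
        linarith

theorem isExponentWithVal_add_one {m ℓ : ℕ} (hm : 0 < m) (hℓ : Odd ℓ) (hℓ1 : 1 < ℓ) (hp : p = 2)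
    (hK : Fintype.card K = p ^ m) (hKF : Module.finrank K F = ℓ) :
    IsExponentWithVal p F (p ^ m + 1) (((ℓ : ℚ) + 1) * (m * ℓ : ℕ) / (2 * ℓ)) := by
  have hF : Fintype.card F = p ^ (m * ℓ) := by
    rw [Module.card_eq_pow_finrank (K := K) (V := F), hK, hKF, pow_mul]
  subst hp
  have : CharP K 2 := charP_of_injective_algebraMap (algebraMap (ZMod 2) K).injective 2
  have heven : Even (2 ^ m) := (even_two.pow_of_ne_zero hm.ne')
  have h := hasMinimalSquare_add_one (K := K) (F := F) 2 rfl (hKF ▸ hℓ) (hK ▸ heven)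
  rw [hK, hKF] at h
  exact h.isExponentWithVal (s := 1) 2 hm hℓ hℓ1 hF heven.add_one (by rw [pow_one])
    (Nat.modEq_one)

theorem isExponentWithVal_sq_sub_add_one {m ℓ : ℕ} (hm : 0 < m) (hℓ : Odd ℓ) (hℓ1 : 1 < ℓ)
    (hK : Fintype.card K = p ^ m) (hKF : Module.finrank K F = ℓ) :
    IsExponentWithVal p F (p ^ (2 * m) - p ^ m + 1)
      (((ℓ : ℚ) + 1) * (m * ℓ : ℕ) / (2 * ℓ)) := by
  have hF : Fintype.card F = p ^ (m * ℓ) := by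
    rw [Module.card_eq_pow_finrank (K := K) (V := F), hK, hKF, pow_mul]
  have h := hasMinimalSquare_sq_sub_add_one (K := K) (F := F) p (hKF ▸ hℓ)
  rw [hK, hKF] at h
  rw [mul_comm 2 m, pow_mul]
  obtain ⟨u, hu⟩ : ∃ u, p ^ m = u + 1 :=
    Nat.exists_eq_succ_of_ne_zero (pow_ne_zero _ (NeZero.ne p))
  have hdu : (p ^ m) ^ 2 - p ^ m + 1 = u * (u + 1) + 1 := by
    rw [hu, show (u + 1) ^ 2 = u * (u + 1) + (u + 1) by ring, Nat.add_sub_cancel]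
  refine h.isExponentWithVal (s := 3) p hm hℓ hℓ1 hF ?_ ?_ ?_
  · rw [hdu]
    exact (Nat.even_mul_succ_self u).add_one
  · rw [hdu, hu]
    exact ⟨u + 2, by ring⟩
  · obtain ⟨w, hw⟩ : p - 1 ∣ u := by
      have := Nat.sub_one_dvd_pow_sub_one p m
      rwa [hu, Nat.add_sub_cancel] at this
    rw [hdu, hw, mul_assoc, add_comm]
    simp [Nat.ModEq]

theorem isExponentWithVal_sq_add_one_div_two {m ℓ : ℕ} (hm : 0 < m) (hℓ : Odd ℓ) (hℓ1 : 1 < ℓ)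
    (hp : p ≠ 2) (hK : Fintype.card K = p ^ m) (hKF : Module.finrank K F = ℓ) :
    IsExponentWithVal p F ((p ^ (2 * m) + 1) / 2)
      (((ℓ : ℚ) + 1) * (m * ℓ : ℕ) / (2 * ℓ)) := by
  have hF : Fintype.card F = p ^ (m * ℓ) := by
    rw [Module.card_eq_pow_finrank (K := K) (V := F), hK, hKF, pow_mul]
  have hpodd : Odd p := (Fact.out : p.Prime).odd_of_ne_two hp
  have hQ : Odd (p ^ m) := hpodd.pow
  have hchar : CharP K p := charP_of_injective_algebraMap (algebraMap (ZMod p) K).injective p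
  have h2 : (2 : K) ≠ 0 := by
    intro h
    have h3 : p ∣ 2 := (CharP.cast_eq_zero_iff K p 2).mp (by exact_mod_cast h)
    exact hp ((Nat.prime_dvd_prime_iff_eq Fact.out Nat.prime_two).mp h3)
  have h := hasMinimalSquare_sq_add_one_div_two (K := K) (F := F) p h2 (hK ▸ hQ) (hKF ▸ hℓ)
  rw [hK, hKF] at h
  rw [mul_comm 2 m, pow_mul]
  obtain ⟨u, hu⟩ := hQ
  have hdu : ((p ^ m) ^ 2 + 1) / 2 = 2 * (u * (u + 1)) + 1 := by
    rw [hu, show (2 * u + 1) ^ 2 + 1 = 2 * (2 * (u * (u + 1)) + 1) by ring,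
      Nat.mul_div_cancel_left _ two_pos]
  refine h.isExponentWithVal (s := 2) p hm hℓ hℓ1 hF ?_ ?_ ?_
  · rw [hdu]
    exact ⟨_, rfl⟩
  · rw [hdu, hu]
    exact ⟨2, by ring⟩
  · obtain ⟨w, hw⟩ : p - 1 ∣ 2 * u := by
      have := Nat.sub_one_dvd_pow_sub_one p m
      rwa [hu, Nat.add_sub_cancel] at this
    rw [hdu, ← mul_assoc, hw, mul_assoc, add_comm]
    simp [Nat.ModEq]

end Exponents

theorem lemma3p2 (p : ℕ) [Fact p.Prime] (F : Type*) [Field F] [Fintype F] [Algebra (ZMod p) F]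
    (n : ℕ) (hn : Module.finrank (ZMod p) F = n) (hn2 : ¬ ∃ k : ℕ, n = 2 ^ k)
    (ℓ : ℕ) (hℓ : IsLeast {r : ℕ | r.Prime ∧ Odd r ∧ r ∣ n} ℓ) :
    (∃ d : ℕ, IsExponentWithVal p F d (((ℓ : ℚ) + 1) * n / (2 * ℓ))) ∧
    (p = 2 →
      IsExponentWithVal p F (2 ^ (n / ℓ) + 1) (((ℓ : ℚ) + 1) * n / (2 * ℓ)) ∧
      IsExponentWithVal p F (2 ^ (2 * (n / ℓ)) - 2 ^ (n / ℓ) + 1)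
        (((ℓ : ℚ) + 1) * n / (2 * ℓ))) ∧
    (p ≠ 2 →
      IsExponentWithVal p F ((p ^ (2 * (n / ℓ)) + 1) / 2) (((ℓ : ℚ) + 1) * n / (2 * ℓ)) ∧
      IsExponentWithVal p F (p ^ (2 * (n / ℓ)) - p ^ (n / ℓ) + 1)
        (((ℓ : ℚ) + 1) * n / (2 * ℓ))) ∧
    (3 ∣ n → ∃ d : ℕ, IsExponentWithVal p F d (2 / 3 * (n : ℚ))) := by
  obtain ⟨⟨hprime, hodd, hdvd⟩, hmin⟩ := hℓ
  obtain ⟨m, hm⟩ := hdvd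
  have hn0 : 0 < n := hn ▸ Module.finrank_pos
  have hm0 : 0 < m := by
    rcases Nat.eq_zero_or_pos m with rfl | h
    · omega
    · exact h
  have hdiv : n / ℓ = m := by rw [hm, Nat.mul_div_cancel_left _ hprime.pos]
  have hn' : n = m * ℓ := by rw [hm, mul_comm]
  have hKm : Module.finrank (ZMod p) (GaloisField p m) = m := GaloisField.finrank p hm0.ne'
  obtain ⟨f⟩ := FiniteField.nonempty_algHom_of_finrank_dvd (F := ZMod p) (K := GaloisField p m)
    (L := F) (by rw [hKm, hn, hn']; exact dvd_mul_right m ℓ)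
  let : Fintype (GaloisField p m) := Fintype.ofFinite _
  let : Algebra (GaloisField p m) F := f.toRingHom.toAlgebra
  have : IsScalarTower (ZMod p) (GaloisField p m) F :=
    IsScalarTower.of_algebraMap_eq fun x => (f.commutes x).symm
  have hK : Fintype.card (GaloisField p m) = p ^ m := by
    rw [Module.card_eq_pow_finrank (K := ZMod p), hKm, ZMod.card]
  have hKF : Module.finrank (GaloisField p m) F = ℓ := by
    have h := Module.finrank_mul_finrank (ZMod p) (GaloisField p m) F
    rw [hKm, hn, hn'] at h
    exact Nat.eq_of_mul_eq_mul_left hm0 h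
  rw [hdiv, hn']
  have hB := isExponentWithVal_sq_sub_add_one p hm0 hodd hprime.one_lt hK hKF
  refine ⟨⟨_, hB⟩, ?_, ?_, ?_⟩
  · rintro rfl
    exact ⟨isExponentWithVal_add_one 2 hm0 hodd hprime.one_lt rfl hK hKF, hB⟩
  · intro hp
    exact ⟨isExponentWithVal_sq_add_one_div_two p hm0 hodd hprime.one_lt hp hK hKF, hB⟩
  · intro h3
    have hℓ3 : ℓ = 3 := by
      have h1 := hmin ⟨Nat.prime_three, by decide, by rw [hn']; exact h3⟩
      have h2 := hprime.two_le
      interval_cases ℓ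
      · exact absurd hodd (by decide)
      · rfl
    refine ⟨p ^ (2 * m) - p ^ m + 1, ?_⟩
    convert hB using 1
    rw [hℓ3]
    push_cast
    ring
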